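/- **Setting.** A *loopless mixed graph* $G$ has a finite node set $V$ and a set of edges, each joining two distinct nodes and being a line ($i - j$, no arrowhead), an arrow ($i\to j$, arrowhead at $j$) or an arc ($i\leftrightarrow j$, arrowheads at both ends); multiple edges, of the same or of different types, are allowed. A *path* is a walk with no repeated node or edge. An inner node of a path is a *collider* on it if both adjacent edges of the path have an arrowhead at it, and a *non-collider* otherwise. $\mathrm{an}(j)$ is the set of nodes $i\neq j$ from which a path of arrows, all directed towards $j$, leads to $j$; then $j$ is a *descendant* of $i$; $\mathrm{an}(C)=\bigcup_{c\in C}\mathrm{an}(c)$. For pairwise disjoint $A,B,C\subseteq V$, write $A\perp_m B\mid C$ if there is no path between a node of $A$ and a node of $B$ whose colliders are all in $C\cup\mathrm{an}(C)$ and whose non-colliders are all outside $C$. Let $\mathcal J_m(G)$ be the set of triples $\langle A,B\mid C\rangle$ with $A\perp_m B\mid C$. A *ribbon* is a three-node path $\langle h,i,j\rangle$ whose inner node $i$ is a collider, such that (1) there is no edge between $h$ and $j$ that has an arrowhead at $h$ iff the $hi$-edge of the path does, and an arrowhead at $j$ iff the $ij$-edge of the path does; and (2) $i$ or a descendant of $i$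 is an endpoint of a line or lies on a directed cycle of arrows (cycles of length two included). $G$ is *ribbonless* if it contains no ribbon. A ribbonless graph $G$ is *maximal* if adding to $G$ any edge (line, arrow or arc) between two distinct non-adjacent nodes changes $\mathcal J_m(G)$. The *anterior graph* $G^*$ is obtained from $G$ by recursively removing arrowheads that point to endpoints of lines (an arrow then becomes a line, an arc becomes an arrow) until there are none. $\mathrm{ant}(j)$ is the set of nodes $i\neq j$ for which $G^*$ has a path from $i$ to $j$ of the form $i - \cdots - i_m\to\cdots\to j$ (a possibly empty sequence of lines followed by a possibly empty sequence of arrows directed towards $j$). An *independence model* $\mathcal J$ over $V$ is a set of triples $\langle A,B\mid C\rangle$ of pairwise disjoint subsets of $V$ that contains all those with $A=\varnothing$ or $B=\varnothing$. It is *probabilistic* if there are measurable spaces $\mathcal X_\alpha$ ($\alpha\in V$) and a joint probability distribution $P$ of random variables $X_\alpha\in\mathcal X_\alpha$ such that, for all pairwise disjoint $A,B,C$, $\langle A,B\mid C\rangle\in\mathcal J$ if and only if $X_A$ is conditionally independent of $X_B$ given $X_C$, i.e. for every measurable $S\subseteq\mathcal X_A=\prod_{\alpha\in A}\mathcal X_\alpha$,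 almost surely $P(X_A\in S\mid X_B,X_C)=P(X_A\in S\mid X_C)$. For pairwise disjoint $A,B,C,D$, *intersection* says that $\langle A,B\mid C\cup D\rangle,\langle A,D\mid C\cup B\rangle\in\mathcal J$ imply $\langle A,B\cup D\mid C\rangle\in\mathcal J$, and *composition* says that $\langle A,B\mid C\rangle,\langle A,D\mid C\rangle\in\mathcal J$ imply $\langle A,B\cup D\mid C\rangle\in\mathcal J$. **Corollary.** Let $G$ be a maximal ribbonless graph with node set $V$, and let $\mathcal J$ be a probabilistic independence model over $V$ that satisfies intersection and composition. Then $\mathcal J$ satisfies the pairwise Markov property with respect to $G$, $$\langle \{i\},\{j\}\mid (\mathrm{ant}(i)\cup\mathrm{ant}(j))\setminus\{i,j\}\rangle\in\mathcal J\quad\text{for all distinct non-adjacent nodes } i,j,$$ if and only if it satisfies the global Markov property with respect to $G$, $$A\perp_m B\mid C\ \Longrightarrow\ \langle A,B\mid C\rangle\in\mathcal J\quad\text{for all pairwise disjoint } A,B,C\subseteq V.$$ -/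

import Mathlib

open MeasureTheory

universe u v w

/-! ### Independence models -/

/-- An independence model over `V`: a set of statements `⟨A, B | C⟩` (coded as `(A, B, C)`) about
disjoint subsets of `V`, always containing the statements whose first or second entry is empty. -/
@[ext]
structure IndependenceModel (V : Type u) where
  stmts : Set (Set V × Set V × Set V)
  disjoint' : ∀ A B C : Set V, (A, B, C) ∈ stmts → Disjoint A B ∧ Disjoint A C ∧ Disjoint B C
  empty_left' : ∀ B C : Set V, Disjoint B C → (∅, B, C) ∈ stmts
  empty_right' : ∀ A C : Set V, Disjoint A C → (A, ∅, C) ∈ stmts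

namespace IndependenceModel

/-- `J.Indep A B C` means `⟨A, B | C⟩ ∈ J`. -/
def Indep {V : Type u} (J : IndependenceModel V) (A B C : Set V) : Prop :=
  (A, B, C) ∈ J.stmts

/-- If `⟨A, B | C ∪ D⟩ ∈ J` and `⟨A, D | C ∪ B⟩ ∈ J`, then `⟨A, B ∪ D | C⟩ ∈ J`. -/
def Intersection {V : Type u} (J : IndependenceModel V) : Prop :=
  ∀ A B C D : Set V, Disjoint A B → Disjoint A C → Disjoint A D → Disjoint B C → Disjoint B D →
    Disjoint C D → J.Indep A B (C ∪ D) → J.Indep A D (C ∪ B) → J.Indep A (B ∪ D) C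

/-- If `⟨A, B | C⟩ ∈ J` and `⟨A, D | C⟩ ∈ J`, then `⟨A, B ∪ D | C⟩ ∈ J`. -/
def Composition {V : Type u} (J : IndependenceModel V) : Prop :=
  ∀ A B C D : Set V, Disjoint A B → Disjoint A C → Disjoint A D → Disjoint B C → Disjoint B D →
    Disjoint C D → J.Indep A B C → J.Indep A D C → J.Indep A (B ∪ D) C

end IndependenceModel

/-! ### Probabilistic independence models -/

/-- The σ-algebra on `∏ α, 𝓧 α` generated by the coordinates in `A`, i.e. by `X_A`. -/
@[reducible] def coordSigma {V : Type u} (𝓧 : V → Type w) [∀ α, MeasurableSpace (𝓧 α)] (A : Set V) :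
    MeasurableSpace (∀ α, 𝓧 α) :=
  MeasurableSpace.comap A.domRestrict MeasurableSpace.pi

/-- `X_A` is conditionally independent of `X_B` given `X_C` under the joint distribution `P`: for
every measurable set `S` of values of `X_A`, almost surely
`P(X_A ∈ S | X_B, X_C) = P(X_A ∈ S | X_C)`. -/
def CondIndepCoord {V : Type u} {𝓧 : V → Type w} [∀ α, MeasurableSpace (𝓧 α)]
    (P : Measure (∀ α, 𝓧 α)) (A B C : Set V) : Prop :=
  ∀ S : Set (∀ α : A, 𝓧 α), MeasurableSet S →
    P[(A.domRestrict ⁻¹' S).indicator (fun _ => (1 : ℝ)) | coordSigma 𝓧 B ⊔ coordSigma 𝓧 C]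
      =ᵐ[P] P[(A.domRestrict ⁻¹' S).indicator (fun _ => (1 : ℝ)) | coordSigma 𝓧 C]

theorem coordSigma_le {V : Type u} (𝓧 : V → Type w) [∀ α, MeasurableSpace (𝓧 α)] (A : Set V) :
    coordSigma 𝓧 A ≤ MeasurableSpace.pi := by
  unfold coordSigma
  rw [← measurable_iff_comap_le]
  exact measurable_pi_lambda _ fun a => measurable_pi_apply _

theorem coordSigma_empty {V : Type u} (𝓧 : V → Type w) [∀ α, MeasurableSpace (𝓧 α)] :
    coordSigma 𝓧 (∅ : Set V) = ⊥ := by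
  have h : (Set.domRestrict (π := 𝓧) (∅ : Set V)) = fun _ => (fun a => a.2.elim) := by
    funext x a
    exact a.2.elim
  unfold coordSigma
  rw [h, MeasurableSpace.comap_const]

theorem condIndepCoord_empty_right {V : Type u} {𝓧 : V → Type w} [∀ α, MeasurableSpace (𝓧 α)]
    (P : Measure (∀ α, 𝓧 α)) (A C : Set V) : CondIndepCoord P A ∅ C := by
  intro S _
  rw [coordSigma_empty, bot_sup_eq]

theorem condIndepCoord_empty_left {V : Type u} {𝓧 : V → Type w} [∀ α, MeasurableSpace (𝓧 α)]
    (P : Measure (∀ α, 𝓧 α)) [IsProbabilityMeasure P] (B C : Set V) :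
    CondIndepCoord P ∅ B C := by
  intro S _
  have h : ∃ c : ℝ, (((∅ : Set V).domRestrict (π := 𝓧)) ⁻¹' S).indicator (fun _ => (1 : ℝ))
      = fun _ => c := by
    by_cases hS : (fun a : (∅ : Set V) => (a.2.elim : 𝓧 a)) ∈ S
    · refine ⟨1, funext fun x => Set.indicator_of_mem ?_ _⟩
      have : (∅ : Set V).domRestrict x = fun a : (∅ : Set V) => (a.2.elim : 𝓧 a) :=
        funext fun a => a.2.elim
      simpa [Set.mem_preimage, this] using hS
    · refine ⟨0, funext fun x => Set.indicator_of_notMem ?_ _⟩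
      have : (∅ : Set V).domRestrict x = fun a : (∅ : Set V) => (a.2.elim : 𝓧 a) :=
        funext fun a => a.2.elim
      simpa [Set.mem_preimage, this] using hS
  obtain ⟨c, hc⟩ := h
  rw [hc, condExp_const (sup_le (coordSigma_le 𝓧 B) (coordSigma_le 𝓧 C)),
    condExp_const (coordSigma_le 𝓧 C)]

/-- The independence model `J(P)` induced by the joint distribution `P` of `(X_α)_{α ∈ V}`. -/
def IndependenceModel.ofMeasure {V : Type u} {𝓧 : V → Type w} [∀ α, MeasurableSpace (𝓧 α)]
    (P : Measure (∀ α, 𝓧 α)) [IsProbabilityMeasure P] : IndependenceModel V where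
  stmts := {t | (Disjoint t.1 t.2.1 ∧ Disjoint t.1 t.2.2 ∧ Disjoint t.2.1 t.2.2) ∧
    CondIndepCoord P t.1 t.2.1 t.2.2}
  disjoint' := fun _ _ _ h => h.1
  empty_left' := fun B C h =>
    ⟨⟨Set.empty_disjoint B, Set.empty_disjoint C, h⟩, condIndepCoord_empty_left P B C⟩
  empty_right' := fun A C h =>
    ⟨⟨Set.disjoint_empty A, h, Set.empty_disjoint C⟩, condIndepCoord_empty_right P A C⟩

/-- `J` is probabilistic: `J = J(P)` for the joint distribution `P` of some random variables
`(X_α)_{α ∈ V}` with arbitrary measurable state spaces. -/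
def IndependenceModel.IsProbabilistic {V : Type u} (J : IndependenceModel V) : Prop :=
  ∃ (𝓧 : V → Type w) (_ : ∀ α, MeasurableSpace (𝓧 α)) (P : Measure (∀ α, 𝓧 α))
    (_ : IsProbabilityMeasure P), J = IndependenceModel.ofMeasure P

/-! ### Loopless mixed graphs -/

/-- A loopless mixed graph with node set `V` and edge set `E` (multiple edges, of the same or of
different types, are allowed). Each edge has two distinct endpoints, and carries an arrowhead at
none of them (a line), at exactly one (an arrow pointing to it), or at both (an arc). -/
structure LMG (V : Type u) (E : Type v) where
  /-- the endpoints of an edge -/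
  ends : E → Sym2 V
  /-- the endpoints of an edge at which it has an arrowhead -/
  head : E → Set V
  head_sub : ∀ e, ∀ x ∈ head e, x ∈ ends e
  loopless : ∀ e, ¬ (ends e).IsDiag

namespace LMG

variable {V : Type u} {E : Type v}

/-- `e` is a line between `i` and `j`. -/
def IsLine (G : LMG V E) (e : E) (i j : V) : Prop := G.ends e = s(i, j) ∧ G.head e = ∅

/-- `e` is an arrow from `i` to `j`. -/
def IsArrow (G : LMG V E) (e : E) (i j : V) : Prop := G.ends e = s(i, j) ∧ G.head e = {j}

/-- There is a line between `i` and `j`. -/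
def Line (G : LMG V E) (i j : V) : Prop := ∃ e, G.IsLine e i j

/-- There is an arrow from `i` to `j`. -/
def Arrow (G : LMG V E) (i j : V) : Prop := ∃ e, G.IsArrow e i j

/-- `i ∼ j`. -/
def Adj (G : LMG V E) (i j : V) : Prop := ∃ e, G.ends e = s(i, j)

/-- The ancestors `an(j)`: the nodes other than `j` from which a direction-preserving path leads
to `j`. -/
def an (G : LMG V E) (j : V) : Set V := {i | i ≠ j ∧ Relation.TransGen G.Arrow i j}

/-- `an(C)`, the union of the sets `an(c)`, `c ∈ C`. -/
def anSet (G : LMG V E) (C : Set V) : Set V := ⋃ c ∈ C, G.an c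

/-! ### Paths and m-separation -/

/-- Walks `⟨v₀, e₁, v₁, …, e_k, v_k⟩`. -/
inductive Walk (G : LMG V E) : V → V → Type (max u v)
  | nil (a : V) : Walk G a a
  | cons {a b c : V} (e : E) (h : G.ends e = s(a, b)) (p : Walk G b c) : Walk G a c

namespace Walk

/-- The list of nodes of a walk. -/
def nodes {G : LMG V E} : {a b : V} → G.Walk a b → List V
  | _, _, .nil a => [a]
  | a, _, .cons _ _ p => a :: p.nodes

/-- The list of edges of a walk. -/
def edges {G : LMG V E} : {a b : V} → G.Walk a b → List E
  | _, _, .nil _ => []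
  | _, _, .cons e _ p => e :: p.edges

/-- The tripaths of a walk: its inner nodes `t`, in the form `(e, t, f)`, where `e` and `f` are the
edges of the walk just before and just after `t`. -/
def tripaths {G : LMG V E} : {a b : V} → G.Walk a b → List (E × V × E)
  | _, _, .nil _ => []
  | _, _, .cons _ _ (.nil _) => []
  | _, _, .cons e _ (.cons (a := t) f h p) => (e, t, f) :: (Walk.cons f h p).tripaths

/-- A path is a walk with no repeated node or edge. -/
def IsPath {G : LMG V E} {a b : V} (p : G.Walk a b) : Prop := p.nodes.Nodup ∧ p.edges.Nodup

end Walk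

/-- The node `t` is a collider between the edges `e` and `f`: both have an arrowhead at `t`. -/
def Collider (G : LMG V E) (e : E) (t : V) (f : E) : Prop := t ∈ G.head e ∧ t ∈ G.head f

/-- A path is m-connecting given `C` if all its collider nodes are in `C ∪ an(C)` and all its
non-collider (inner) nodes are outside `C`. -/
def MConnecting (G : LMG V E) (C : Set V) {a b : V} (p : G.Walk a b) : Prop :=
  p.IsPath ∧ ∀ e t f, (e, t, f) ∈ p.tripaths →
    (G.Collider e t f → t ∈ C ∪ G.anSet C) ∧ (¬ G.Collider e t f → t ∉ C)

/-- `A ⊥ₘ B | C`: no path between `A` and `B` is m-connecting given `C`. -/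
def MSep (G : LMG V E) (A B C : Set V) : Prop :=
  ∀ a ∈ A, ∀ b ∈ B, ∀ p : G.Walk a b, ¬ G.MConnecting C p

/-- The independence model `Jₘ(G)` induced by m-separation. -/
def indepModel (G : LMG V E) : IndependenceModel V where
  stmts := {t | (Disjoint t.1 t.2.1 ∧ Disjoint t.1 t.2.2 ∧ Disjoint t.2.1 t.2.2) ∧
    G.MSep t.1 t.2.1 t.2.2}
  disjoint' := fun _ _ _ h => h.1
  empty_left' := fun B C h =>
    ⟨⟨Set.empty_disjoint B, Set.empty_disjoint C, h⟩, fun _ ha => ha.elim⟩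
  empty_right' := fun A C h =>
    ⟨⟨Set.disjoint_empty A, h, Set.empty_disjoint C⟩, fun _ _ _ hb => hb.elim⟩

/-! ### Ribbonless and maximal graphs -/

/-- The edges `e` (between `h` and `i`) and `f` (between `i` and `j`) form a ribbon `⟨h, i, j⟩`:
a collider tripath without an endpoint-identical edge between `h` and `j`, such that `i` or a
descendant of `i` is the endpoint of a line or lies on a direction-preserving cycle. -/
def IsRibbon (G : LMG V E) (h i j : V) (e f : E) : Prop :=
  h ≠ i ∧ i ≠ j ∧ h ≠ j ∧ G.ends e = s(h, i) ∧ G.ends f = s(i, j) ∧ G.Collider e i f ∧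
  (¬ ∃ g, G.ends g = s(h, j) ∧ (h ∈ G.head g ↔ h ∈ G.head e) ∧ (j ∈ G.head g ↔ j ∈ G.head f)) ∧
  ∃ k, (k = i ∨ i ∈ G.an k) ∧ ((∃ l, G.Line k l) ∨ Relation.TransGen G.Arrow k k)

/-- No tripath of `G` is a ribbon. -/
def Ribbonless (G : LMG V E) : Prop := ∀ h i j e f, ¬ G.IsRibbon h i j e f

/-- The graph `G` with one new edge between the distinct nodes `i` and `j`, whose arrowheads are at
the nodes in `H ⊆ {i, j}`. -/
def addEdge (G : LMG V E) (i j : V) (hij : i ≠ j) (H : Set V) (hH : H ⊆ {i, j}) :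
    LMG V (Option E) where
  ends := fun o => o.elim s(i, j) G.ends
  head := fun o => o.elim H G.head
  head_sub := by
    rintro (_ | e) x hx
    · simpa using hH hx
    · exact G.head_sub e x hx
  loopless := by
    rintro (_ | e)
    · simpa using hij
    · exact G.loopless e

/-- `G` is maximal: adding any edge (a line, an arrow or an arc) between non-adjacent nodes changes
the independence model induced by m-separation. -/
def Maximal (G : LMG V E) : Prop :=
  ∀ (i j : V) (hij : i ≠ j) (H : Set V) (hH : H ⊆ {i, j}), ¬ G.Adj i j →
    (G.addEdge i j hij H hH).indepModel ≠ G.indepModel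

/-! ### Anterior graphs and the Markov properties -/

/-- The arrowheads removed in forming the anterior graph: the arrowhead of `e` at `x` is removed as
soon as `x` is the endpoint of an edge `f` that is a line, either from the start or because all the
arrowheads of `f` have been removed before. -/
inductive HeadRemoved (G : LMG V E) : E → V → Prop
  | step (e f : E) (x : V) (he : x ∈ G.head e) (hf : x ∈ G.ends f)
      (hline : ∀ y ∈ G.head f, HeadRemoved G f y) : HeadRemoved G e x

/-- The anterior graph `G*`: arrowheads pointing to endpoints of lines are recursively removed. -/
def anterior (G : LMG V E) : LMG V E where
  ends := G.ends
  head := fun e => {x | x ∈ G.head e ∧ ¬ G.HeadRemoved e x}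
  head_sub := fun e x hx => G.head_sub e x hx.1
  loopless := G.loopless

/-- The anteriors `ant(j)`: the nodes `i ≠ j` with a path in `G*` from `i` to `j` that consists of
lines followed by arrows directed towards `j` (either part may be absent). -/
def ant (G : LMG V E) (j : V) : Set V :=
  {i | i ≠ j ∧ ∃ m, Relation.ReflTransGen G.anterior.Line i m ∧
    Relation.ReflTransGen G.anterior.Arrow m j}

/-- The global Markov property of `J` with respect to `G`. -/
def GlobalMarkov (G : LMG V E) (J : IndependenceModel V) : Prop :=
  ∀ A B C : Set V, Disjoint A B → Disjoint A C → Disjoint B C → G.MSep A B C → J.Indep A B C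

/-- The pairwise Markov property of `J` with respect to `G`. -/
def PairwiseMarkov (G : LMG V E) (J : IndependenceModel V) : Prop :=
  ∀ i j : V, i ≠ j → ¬ G.Adj i j → J.Indep {i} {j} ((G.ant i ∪ G.ant j) \ {i, j})

end LMG

/-! ### Conditional independence of coordinates -/

/-! The probabilistic hypothesis enters only through the semigraphoid axioms, proved here for
arbitrary state spaces from properties of conditional expectations. The rest is graph theory and
formal manipulation of independence statements.

m-connecting paths are awkward to concatenate, so they are replaced by weakly connecting walks:
repetitions are allowed, and a collider may also lie in the ribbon core (a line or a directed cycle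
at or below it). In a ribbonless graph a shortest such walk is an m-connecting path, because closed
detours can be cut out and a collider in the core is bypassed by an endpoint-identical edge. Hence
m-separation is the absence of weakly connecting walks (`mSep_iff`).

Global implies pairwise (`Maximal.not_linked`): a connection of non-adjacent `a`, `b` given their
anteriors can be taken with inner nodes that are all colliders and directed ancestors of `a` or `b`.
An edge with the same arrowheads at `a` and `b` could then be added without changing the model,
against maximality.

Pairwise implies global. For an anterior-closed set `N`, nodes not joined by a walk of colliders in
`N` are independent given the rest of `N` (`PairwiseMarkov.indepRest`); the induction on `N` removes
sink classes of the anterior preorder. For general `C` (`PairwiseMarkov.indep_singleton`), missing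
anteriors `r` of `{a, b} ∪ C` are added to `C` one at a time and removed again by intersection.
Composition passes from single nodes to sets. -/

theorem coordSigma_union {V : Type u} (𝓧 : V → Type w) [∀ α, MeasurableSpace (𝓧 α)] (A B : Set V) :
    coordSigma 𝓧 (A ∪ B) = coordSigma 𝓧 A ⊔ coordSigma 𝓧 B := by
  have key : ∀ A : Set V, coordSigma 𝓧 A =
      ⨆ a ∈ A, MeasurableSpace.comap (fun x : ∀ α, 𝓧 α => x a) inferInstance := by
    intro A
    unfold coordSigma MeasurableSpace.pi
    rw [MeasurableSpace.comap_iSup, iSup_subtype']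
    simp only [MeasurableSpace.comap_comp]
    rfl
  rw [key, key, key, iSup_union]

section CondIndep

variable {V : Type u} {𝓧 : V → Type w} [∀ α, MeasurableSpace (𝓧 α)]
  {P : Measure (∀ α, 𝓧 α)} {A B C D : Set V}

theorem condIndepCoord_contraction (h : CondIndepCoord P A B C)
    (h' : CondIndepCoord P A D (B ∪ C)) : CondIndepCoord P A (B ∪ D) C := by
  intro S hS
  have h1 := h S hS
  have h2 := h' S hS
  have e1 : coordSigma 𝓧 (B ∪ D) ⊔ coordSigma 𝓧 C = coordSigma 𝓧 D ⊔ coordSigma 𝓧 (B ∪ C) := by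
    rw [coordSigma_union, coordSigma_union, sup_comm (coordSigma 𝓧 B), sup_assoc]
  rw [e1]
  rw [← coordSigma_union] at h1
  exact h2.trans h1

variable [IsProbabilityMeasure P]

theorem integrable_indicator_coord {S : Set (∀ α : A, 𝓧 α)} (hS : MeasurableSet S) :
    Integrable ((A.domRestrict ⁻¹' S).indicator (fun _ => (1 : ℝ))) P :=
  (integrable_const 1).indicator (coordSigma_le 𝓧 A _ ⟨S, hS, rfl⟩)

/-- Tower property: the conditional probability given the larger σ-algebra is already measurable
with respect to `X_C`, so projecting onto the smaller one leaves it unchanged. -/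
theorem condIndepCoord_decomposition (h : CondIndepCoord P A (B ∪ D) C) :
    CondIndepCoord P A B C := by
  intro S hS
  have h1 := h S hS
  have hBC : coordSigma 𝓧 B ⊔ coordSigma 𝓧 C ≤ MeasurableSpace.pi :=
    sup_le (coordSigma_le 𝓧 B) (coordSigma_le 𝓧 C)
  have hBDC : coordSigma 𝓧 (B ∪ D) ⊔ coordSigma 𝓧 C ≤ MeasurableSpace.pi :=
    sup_le (coordSigma_le 𝓧 _) (coordSigma_le 𝓧 C)
  have hle : coordSigma 𝓧 B ⊔ coordSigma 𝓧 C ≤ coordSigma 𝓧 (B ∪ D) ⊔ coordSigma 𝓧 C := by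
    rw [coordSigma_union]
    exact sup_le_sup_right le_sup_left _
  have h2 := condExp_congr_ae (m := coordSigma 𝓧 B ⊔ coordSigma 𝓧 C) h1
  refine (condExp_condExp_of_le (μ := P) hle hBDC).symm.trans (h2.trans ?_)
  rw [condExp_of_stronglyMeasurable hBC
    (stronglyMeasurable_condExp.mono le_sup_right) integrable_condExp]

/-- Conditioning on `B, D, C` and, by decomposition, on `D, C` both give the conditional probability
given `C` alone. -/
theorem condIndepCoord_weakUnion (h : CondIndepCoord P A (B ∪ D) C) :
    CondIndepCoord P A B (C ∪ D) := by
  have h' : CondIndepCoord P A D C := condIndepCoord_decomposition (by rwa [Set.union_comm] at h)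
  intro S hS
  have h1 := h S hS
  have h2 := h' S hS
  have e1 : coordSigma 𝓧 (B ∪ D) ⊔ coordSigma 𝓧 C = coordSigma 𝓧 B ⊔ coordSigma 𝓧 (C ∪ D) := by
    rw [coordSigma_union, coordSigma_union, sup_assoc, sup_comm (coordSigma 𝓧 D)]
  rw [e1] at h1
  rw [← coordSigma_union, Set.union_comm] at h2
  exact h1.trans h2.symm

/-- The defining condition treats `A` and `B` differently; this product form is symmetric and is the
bridge to `condIndepCoord_symm`. -/
theorem condIndepCoord_condExp_mul (h : CondIndepCoord P A B C) {S : Set (∀ α : A, 𝓧 α)}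
    (hS : MeasurableSet S) {T : Set (∀ α : B, 𝓧 α)} (hT : MeasurableSet T) :
    P[(A.domRestrict ⁻¹' S).indicator (fun _ => (1 : ℝ)) *
        (B.domRestrict ⁻¹' T).indicator (fun _ => (1 : ℝ)) | coordSigma 𝓧 C] =ᵐ[P]
      P[(A.domRestrict ⁻¹' S).indicator (fun _ => (1 : ℝ)) | coordSigma 𝓧 C] *
        P[(B.domRestrict ⁻¹' T).indicator (fun _ => (1 : ℝ)) | coordSigma 𝓧 C] := by
  set s := A.domRestrict (π := 𝓧) ⁻¹' S with hs
  set t := B.domRestrict (π := 𝓧) ⁻¹' T with ht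
  have hC := coordSigma_le 𝓧 C
  have hBC : coordSigma 𝓧 B ⊔ coordSigma 𝓧 C ≤ MeasurableSpace.pi :=
    sup_le (coordSigma_le 𝓧 B) hC
  have htm : MeasurableSet[coordSigma 𝓧 B] t := ⟨T, hT, rfl⟩
  have htm' : MeasurableSet[coordSigma 𝓧 B ⊔ coordSigma 𝓧 C] t :=
    (le_sup_left : coordSigma 𝓧 B ≤ coordSigma 𝓧 B ⊔ coordSigma 𝓧 C) _ htm
  have hmul : ∀ f : (∀ α, 𝓧 α) → ℝ, f * t.indicator (fun _ => (1 : ℝ)) = t.indicator f := by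
    intro f
    funext x
    by_cases hx : x ∈ t <;> simp [hx]
  have hsi : Integrable (s.indicator (fun _ => (1 : ℝ))) P := integrable_indicator_coord hS
  have hti : Integrable (t.indicator (fun _ => (1 : ℝ))) P := integrable_indicator_coord hT
  have h1 : P[s.indicator (fun _ => (1 : ℝ)) * t.indicator (fun _ => (1 : ℝ)) |
      coordSigma 𝓧 B ⊔ coordSigma 𝓧 C] =ᵐ[P]
      P[s.indicator (fun _ => (1 : ℝ)) | coordSigma 𝓧 C] * t.indicator (fun _ => (1 : ℝ)) := by
    rw [hmul, hmul]
    refine (condExp_indicator hsi htm').trans ?_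
    filter_upwards [h S hS] with x hx
    by_cases hxt : x ∈ t <;> simp [hxt, hx, hs]
  have hpi : Integrable (P[s.indicator (fun _ => (1 : ℝ)) | coordSigma 𝓧 C] *
      t.indicator (fun _ => (1 : ℝ))) P := by
    rw [hmul]
    exact integrable_condExp.indicator (coordSigma_le 𝓧 B _ htm)
  refine (condExp_condExp_of_le (μ := P) (le_sup_right (a := coordSigma 𝓧 B)) hBC).symm.trans ?_
  refine (condExp_congr_ae h1).trans ?_
  exact condExp_mul_of_stronglyMeasurable_left stronglyMeasurable_condExp hpi hti

theorem condIndepCoord_symm (h : CondIndepCoord P A B C) : CondIndepCoord P B A C := by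
  intro T hT
  set t := B.domRestrict (π := 𝓧) ⁻¹' T with ht
  have hC := coordSigma_le 𝓧 C
  have hAC : coordSigma 𝓧 A ⊔ coordSigma 𝓧 C ≤ MeasurableSpace.pi :=
    sup_le (coordSigma_le 𝓧 A) hC
  have hti : Integrable (t.indicator (fun _ => (1 : ℝ))) P := integrable_indicator_coord hT
  symm
  have hci : Integrable (P[t.indicator (fun _ => (1 : ℝ)) | coordSigma 𝓧 C]) P := integrable_condExp
  refine ae_eq_condExp_of_forall_setIntegral_eq hAC hti (fun _ _ _ => hci.integrableOn) ?_
    (stronglyMeasurable_condExp.mono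
      (le_sup_right : coordSigma 𝓧 C ≤ coordSigma 𝓧 A ⊔ coordSigma 𝓧 C)).aestronglyMeasurable
  intro F hF _
  -- It suffices to compare integrals over the π-system of intersections of an `X_A`-event and an
  -- `X_C`-event.
  let Q : Set (Set (∀ α, 𝓧 α)) := {F | ∃ S U, MeasurableSet[coordSigma 𝓧 A] S ∧
    MeasurableSet[coordSigma 𝓧 C] U ∧ F = S ∩ U}
  have hgen : coordSigma 𝓧 A ⊔ coordSigma 𝓧 C = MeasurableSpace.generateFrom Q := by
    apply le_antisymm
    · refine sup_le (fun S hS => ?_) (fun U hU => ?_)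
      · exact MeasurableSpace.measurableSet_generateFrom
          ⟨S, Set.univ, hS, MeasurableSet.univ, by simp⟩
      · exact MeasurableSpace.measurableSet_generateFrom
          ⟨Set.univ, U, MeasurableSet.univ, hU, by simp⟩
    · refine MeasurableSpace.generateFrom_le ?_
      rintro _ ⟨S, U, hS, hU, rfl⟩
      exact MeasurableSet.inter
        ((le_sup_left : coordSigma 𝓧 A ≤ coordSigma 𝓧 A ⊔ coordSigma 𝓧 C) _ hS)
        ((le_sup_right : coordSigma 𝓧 C ≤ coordSigma 𝓧 A ⊔ coordSigma 𝓧 C) _ hU)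
  have hpi : IsPiSystem Q := by
    rintro _ ⟨S, U, hS, hU, rfl⟩ _ ⟨S', U', hS', hU', rfl⟩ _
    exact ⟨S ∩ S', U ∩ U', hS.inter hS', hU.inter hU', Set.inter_inter_inter_comm _ _ _ _⟩
  induction F, hF using MeasurableSpace.induction_on_inter hgen hpi with
  | empty => simp
  | basic F hF =>
    obtain ⟨_, U, ⟨S, hS, rfl⟩, hU, rfl⟩ := hF
    set s := A.domRestrict (π := 𝓧) ⁻¹' S with hs
    have hsm : MeasurableSet s := coordSigma_le 𝓧 A _ ⟨S, hS, rfl⟩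
    have hUm : MeasurableSet U := hC _ hU
    have hsi : Integrable (s.indicator (fun _ => (1 : ℝ))) P := integrable_indicator_coord hS
    have hmul : ∀ f : (∀ α, 𝓧 α) → ℝ, s.indicator (fun _ => (1 : ℝ)) * f = s.indicator f := by
      intro f
      funext x
      by_cases hx : x ∈ s <;> simp [hx]
    have e : ∀ f : (∀ α, 𝓧 α) → ℝ, Integrable f P →
        ∫ x in s ∩ U, f x ∂P = ∫ x in U, (P[s.indicator (fun _ => (1 : ℝ)) * f | coordSigma 𝓧 C]) x ∂P := by
      intro f hf
      rw [setIntegral_condExp hC (by rw [hmul]; exact hf.indicator hsm) hU, hmul,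
        setIntegral_indicator hsm, Set.inter_comm]
    -- Both sides are now integrals over `U` of conditional expectations given `X_C`, which agree by
    -- the product formula.
    rw [e _ hci, e _ hti]
    refine setIntegral_congr_ae hUm ?_
    have h1 := condIndepCoord_condExp_mul h hS hT
    have h2 : P[s.indicator (fun _ => (1 : ℝ)) * P[t.indicator (fun _ => (1 : ℝ)) | coordSigma 𝓧 C] |
        coordSigma 𝓧 C] =ᵐ[P] P[s.indicator (fun _ => (1 : ℝ)) | coordSigma 𝓧 C] *
          P[t.indicator (fun _ => (1 : ℝ)) | coordSigma 𝓧 C] :=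
      condExp_mul_of_stronglyMeasurable_right stronglyMeasurable_condExp
        (by rw [hmul]; exact hci.indicator hsm) hsi
    filter_upwards [h1, h2] with x h1 h2 _
    rw [h1, h2]
  | compl F hF ih =>
    have hFm := hAC _ hF
    have h1 := integral_add_compl hFm hci
    have h2 := integral_add_compl hFm hti
    have h3 := integral_condExp (μ := P) (f := t.indicator (fun _ => (1 : ℝ))) hC
    have := ih (measure_lt_top _ _)
    linarith
  | iUnion f hd hf ih =>
    have hfm := fun i => hAC _ (hf i)
    rw [integral_iUnion hfm hd hci.integrableOn, integral_iUnion hfm hd hti.integrableOn]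
    exact tsum_congr fun i => ih i (measure_lt_top _ _)

end CondIndep

/-! ### Semigraphoid properties of probabilistic models -/

namespace IndependenceModel

variable {V : Type u}

/-- The semigraphoid axioms: symmetry, decomposition, weak union and contraction. -/
structure IsSemigraphoid (J : IndependenceModel V) : Prop where
  symm : ∀ {A B C : Set V}, J.Indep A B C → J.Indep B A C
  decomposition : ∀ {A B C D : Set V}, J.Indep A (B ∪ D) C → J.Indep A B C
  -- Disjointness is needed for the new statement to be a triple of disjoint sets.
  weakUnion : ∀ {A B C D : Set V}, Disjoint B D → J.Indep A (B ∪ D) C → J.Indep A B (C ∪ D)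
  contraction : ∀ {A B C D : Set V}, J.Indep A B C → J.Indep A D (B ∪ C) → J.Indep A (B ∪ D) C

theorem IsProbabilistic.isSemigraphoid {J : IndependenceModel V} (hJ : IsProbabilistic.{u, w} J) :
    J.IsSemigraphoid := by
  obtain ⟨𝓧, _, P, _, rfl⟩ := hJ
  refine ⟨fun {A B C} h => ?_, fun {A B C D} h => ?_, fun {A B C D} hd h => ?_,
    fun {A B C D} h h' => ?_⟩
  · obtain ⟨⟨h1, h2, h3⟩, h4⟩ := h
    exact ⟨⟨h1.symm, h3, h2⟩, condIndepCoord_symm h4⟩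
  · obtain ⟨⟨h1, h2, h3⟩, h4⟩ := h
    simp only [Set.disjoint_union_left, Set.disjoint_union_right] at h1 h3
    exact ⟨⟨h1.1, h2, h3.1⟩, condIndepCoord_decomposition h4⟩
  · obtain ⟨⟨h1, h2, h3⟩, h4⟩ := h
    simp only [Set.disjoint_union_left, Set.disjoint_union_right] at h1 h3
    exact ⟨⟨h1.1, Set.disjoint_union_right.2 ⟨h2, h1.2⟩, Set.disjoint_union_right.2 ⟨h3.1, hd⟩⟩,
      condIndepCoord_weakUnion h4⟩
  · obtain ⟨⟨h1, h2, h3⟩, h4⟩ := h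
    obtain ⟨⟨h1', h2', h3'⟩, h4'⟩ := h'
    simp only [Set.disjoint_union_right] at h2' h3'
    exact ⟨⟨Set.disjoint_union_right.2 ⟨h1, h1'⟩, h2, Set.disjoint_union_left.2 ⟨h3, h3'.2⟩⟩,
      condIndepCoord_contraction h4 h4'⟩

end IndependenceModel

namespace LMG

open Relation

variable {V : Type u} {E : Type v} {G : LMG V E}

/-! ### Edges, lines and arrows -/

theorem eq_or_eq_of_mem_head {e : E} {a b x : V} (h : G.ends e = s(a, b)) (hx : x ∈ G.head e) :
    x = a ∨ x = b := by
  have := G.head_sub e x hx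
  rw [h] at this
  simpa using this

theorem ne_of_ends {e : E} {a b : V} (h : G.ends e = s(a, b)) : a ≠ b := by
  have := G.loopless e
  rw [h] at this
  simpa using this

theorem ends_symm {e : E} {a b : V} (h : G.ends e = s(a, b)) : G.ends e = s(b, a) :=
  h.trans Sym2.eq_swap

theorem arrow_of_head {e : E} {a b : V} (h : G.ends e = s(a, b)) (ha : a ∉ G.head e)
    (hb : b ∈ G.head e) : G.Arrow a b := by
  refine ⟨e, h, Set.eq_singleton_iff_unique_mem.2 ⟨hb, fun x hx => ?_⟩⟩
  rcases eq_or_eq_of_mem_head h hx with rfl | rfl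
  · exact (ha hx).elim
  · rfl

theorem line_of_head {e : E} {a b : V} (h : G.ends e = s(a, b)) (ha : a ∉ G.head e)
    (hb : b ∉ G.head e) : G.Line a b := by
  refine ⟨e, h, Set.eq_empty_iff_forall_notMem.2 fun x hx => ?_⟩
  rcases eq_or_eq_of_mem_head h hx with rfl | rfl
  · exact ha hx
  · exact hb hx

theorem Arrow.exists_edge {a b : V} (h : G.Arrow a b) :
    ∃ e, G.ends e = s(a, b) ∧ a ∉ G.head e ∧ b ∈ G.head e := by
  obtain ⟨e, h1, h2⟩ := h
  refine ⟨e, h1, ?_, by simp [h2]⟩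
  simpa [h2] using ne_of_ends h1

theorem Line.exists_edge {a b : V} (h : G.Line a b) :
    ∃ e, G.ends e = s(a, b) ∧ a ∉ G.head e ∧ b ∉ G.head e := by
  obtain ⟨e, h1, h2⟩ := h
  exact ⟨e, h1, by simp [h2], by simp [h2]⟩

theorem Line.symm {a b : V} (h : G.Line a b) : G.Line b a := by
  obtain ⟨e, h1, h2⟩ := h
  exact ⟨e, ends_symm h1, h2⟩

/-- `x` or a descendant of `x` is an endpoint of a line. -/
def LineAnc (G : LMG V E) (x : V) : Prop := ∃ y, ReflTransGen G.Arrow x y ∧ ∃ l, G.Line y l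

/-- `x` or a descendant of `x` is an endpoint of a line or lies on a directed cycle. -/
def RibbonCore (G : LMG V E) : Set V :=
  {x | ∃ k, ReflTransGen G.Arrow x k ∧ ((∃ l, G.Line k l) ∨ TransGen G.Arrow k k)}

theorem LineAnc.of_reach {x y : V} (h : ReflTransGen G.Arrow x y) (hy : G.LineAnc y) :
    G.LineAnc x := by
  obtain ⟨z, h1, h2⟩ := hy
  exact ⟨z, h.trans h1, h2⟩

theorem LineAnc.of_arrow {x y : V} (h : G.Arrow x y) (hy : G.LineAnc y) : G.LineAnc x :=
  hy.of_reach (.single h)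

theorem LineAnc.of_line {x y : V} (h : G.Line x y) : G.LineAnc x := ⟨x, .refl, y, h⟩

/-- An edge without an arrowhead at `a` makes `a` share the property of having a line below. -/
theorem LineAnc.of_tail {e : E} {a b : V} (h : G.ends e = s(a, b)) (ha : a ∉ G.head e)
    (hb : G.LineAnc b) : G.LineAnc a := by
  by_cases hb' : b ∈ G.head e
  · exact hb.of_arrow (arrow_of_head h ha hb')
  · exact .of_line (line_of_head h ha hb')

theorem LineAnc.ribbonCore {x : V} (h : G.LineAnc x) : x ∈ G.RibbonCore := by
  obtain ⟨y, h1, h2⟩ := h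
  exact ⟨y, h1, .inl h2⟩

theorem ribbonCore_of_reach {x y : V} (h : ReflTransGen G.Arrow x y) (hy : y ∈ G.RibbonCore) :
    x ∈ G.RibbonCore := by
  obtain ⟨z, h1, h2⟩ := hy
  exact ⟨z, h.trans h1, h2⟩

theorem ribbonCore_of_cycle {x : V} (h : TransGen G.Arrow x x) : x ∈ G.RibbonCore :=
  ⟨x, .refl, .inr h⟩

/-- In a ribbonless graph a collider in the ribbon core is bypassed by an endpoint-identical
edge. -/
theorem Ribbonless.shortcut (hG : G.Ribbonless) {h i j : V} {e f : E} (he : G.ends e = s(h, i))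
    (hf : G.ends f = s(i, j)) (hhj : h ≠ j) (hei : i ∈ G.head e) (hfi : i ∈ G.head f)
    (hi : i ∈ G.RibbonCore) :
    ∃ g, G.ends g = s(h, j) ∧ (h ∈ G.head g ↔ h ∈ G.head e) ∧ (j ∈ G.head g ↔ j ∈ G.head f) := by
  by_contra hg
  obtain ⟨k, hk, hk'⟩ := hi
  refine hG h i j e f ⟨ne_of_ends he, ne_of_ends hf, hhj, he, hf, ⟨hei, hfi⟩, hg, k, ?_, hk'⟩
  by_cases hki : k = i
  · exact .inl hki
  · refine .inr ⟨Ne.symm hki, ?_⟩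
    rcases reflTransGen_iff_eq_or_transGen.1 hk with h | h
    · exact (hki h).elim
    · exact h

/-! ### Connecting walks -/

/-- The condition on an inner node `x` of a walk: it lies in `D` if it is a collider, and outside
`C` otherwise. The propositions `h` and `h'` tell whether the two edges have an arrowhead at `x`. -/
def Passes (D C : Set V) (h : Prop) (x : V) (h' : Prop) : Prop :=
  (h ∧ h' → x ∈ D) ∧ (¬ (h ∧ h') → x ∉ C)

theorem Passes.symm {D C : Set V} {h h' : Prop} {x : V} (H : Passes D C h x h') :
    Passes D C h' x h := by
  rwa [Passes, and_comm (a := h')]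

/-- `G.Conn D C l a ha b hb`: there is a walk from `a` to `b` with list of inner nodes `l` whose
colliders lie in `D` and whose non-colliders lie outside `C`; the first edge has an arrowhead at
`a` iff `ha`, and the last edge has an arrowhead at `b` iff `hb`. -/
inductive Conn (G : LMG V E) (D C : Set V) : List V → V → Prop → V → Prop → Prop
  | edge {a b : V} {ha hb : Prop} (e : E) (h : G.ends e = s(a, b)) (h1 : ha ↔ a ∈ G.head e)
      (h2 : hb ↔ b ∈ G.head e) : Conn G D C [] a ha b hb
  | cons {a b c : V} {ha h h' hc : Prop} {l : List V} (e : E) (he : G.ends e = s(a, b))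
      (h1 : ha ↔ a ∈ G.head e) (h2 : h ↔ b ∈ G.head e) (ok : Passes D C h b h')
      (p : Conn G D C l b h' c hc) : Conn G D C (b :: l) a ha c hc

namespace Conn

variable {D C D' C' : Set V} {l l₁ l₂ : List V} {a b x : V} {ha hb h h' : Prop}

theorem append (p : G.Conn D C l₁ a ha x h) (ok : Passes D C h x h') (q : G.Conn D C l₂ x h' b hb) :
    G.Conn D C (l₁ ++ x :: l₂) a ha b hb := by
  induction p with
  | edge e he h1 h2 => exact .cons e he h1 h2 ok q
  | cons e he h1 h2 ok' _ ih => exact .cons e he h1 h2 ok' (ih ok q)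

theorem split (p : G.Conn D C (l₁ ++ x :: l₂) a ha b hb) :
    ∃ h h', G.Conn D C l₁ a ha x h ∧ Passes D C h x h' ∧ G.Conn D C l₂ x h' b hb := by
  induction l₁ generalizing a ha with
  | nil =>
    cases p with
    | cons e he h1 h2 ok p => exact ⟨_, _, .edge e he h1 h2, ok, p⟩
  | cons y l₁ ih =>
    cases p with
    | cons e he h1 h2 ok p =>
      obtain ⟨h, h', q, ok', q'⟩ := ih p
      exact ⟨h, h', .cons e he h1 h2 ok q, ok', q'⟩

theorem reverse (p : G.Conn D C l a ha b hb) : G.Conn D C l.reverse b hb a ha := by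
  induction p with
  | edge e he h1 h2 => exact .edge e (ends_symm he) h2 h1
  | cons e he h1 h2 ok p ih =>
    rw [List.reverse_cons]
    exact ih.append ok.symm (.edge e (ends_symm he) h2 h1)

theorem mono (p : G.Conn D C l a ha b hb) (hD : ∀ x ∈ l, x ∈ D → x ∈ D')
    (hC : ∀ x ∈ l, x ∈ C' → x ∈ C) : G.Conn D' C' l a ha b hb := by
  induction p with
  | edge e he h1 h2 => exact .edge e he h1 h2
  | cons e he h1 h2 ok p ih =>
    refine .cons e he h1 h2 ⟨fun h => hD _ (by simp) (ok.1 h), fun h hx => ok.2 h (hC _ (by simp) hx)⟩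
      (ih (fun x hx => hD x (by simp [hx])) fun x hx => hC x (by simp [hx]))

/-- Colliders may be restricted to those nodes that satisfy a property of all colliders. -/
theorem upgrade (p : G.Conn D C l a ha b hb)
    (H : ∀ l₁ x l₂, l = l₁ ++ x :: l₂ → x ∈ D → G.Conn D C l₁ a ha x True →
      G.Conn D C l₂ x True b hb → x ∈ D') : G.Conn D' C l a ha b hb := by
  induction p with
  | edge e he h1 h2 => exact .edge e he h1 h2
  | @cons a b c ha h h' hc l e he h1 h2 ok p ih =>
    refine .cons e he h1 h2 ⟨fun hh => ?_, ok.2⟩ (ih fun l₁ x l₂ hl hx q q' => ?_)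
    · refine H [] b l rfl (ok.1 hh) (.edge e he h1 (by simp [← h2, hh.1])) ?_
      rwa [eq_true hh.2] at p
    · exact H (b :: l₁) x l₂ (by simp [hl]) hx (.cons e he h1 h2 ok q) q'

/-- A walk is cut off at the first occurrence of its last node. -/
theorem exists_notMem_right (p : G.Conn D C l a ha b hb) :
    ∃ l' hb', b ∉ l' ∧ l' ⊆ l ∧ G.Conn D C l' a ha b hb' := by
  induction p with
  | edge e he h1 h2 => exact ⟨[], _, by simp, by simp, .edge e he h1 h2⟩
  | @cons a x b ha h h' hc l e he h1 h2 ok p ih =>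
    by_cases hx : b = x
    · subst hx
      exact ⟨[], _, by simp, by simp, .edge e he h1 h2⟩
    · obtain ⟨l', hb', h3, h4, q⟩ := ih
      exact ⟨x :: l', hb', by simp [hx, h3], List.cons_subset_cons _ h4, .cons e he h1 h2 ok q⟩

theorem exists_notMem_left (p : G.Conn D C l a ha b hb) :
    ∃ l' ha', a ∉ l' ∧ l' ⊆ l ∧ G.Conn D C l' a ha' b hb := by
  obtain ⟨l', ha', h1, h2, q⟩ := p.reverse.exists_notMem_right
  refine ⟨l'.reverse, ha', by simpa, fun x hx => ?_, q.reverse⟩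
  simpa using h2 (by simpa using hx)

theorem exists_notMem_both (p : G.Conn D C l a ha b hb) :
    ∃ l' ha' hb', a ∉ l' ∧ b ∉ l' ∧ l' ⊆ l ∧ G.Conn D C l' a ha' b hb' := by
  obtain ⟨l₁, hb', h1, h2, q⟩ := p.exists_notMem_right
  obtain ⟨l₂, ha', h3, h4, q'⟩ := q.exists_notMem_left
  exact ⟨l₂, ha', hb', h3, fun h => h1 (h4 h), fun x hx => h2 (h4 hx), q'⟩

/-- The last edge of a walk, and its replacement by an edge with the same arrowhead at the last
inner node. -/
theorem exists_last (p : G.Conn D C l a ha b hb) :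
    ∃ y e, G.ends e = s(y, b) ∧ (hb ↔ b ∈ G.head e) ∧ y ∈ a :: l ∧
      ∀ g z, G.ends g = s(y, z) → (y ∈ G.head g ↔ y ∈ G.head e) →
        G.Conn D C l a ha z (z ∈ G.head g) := by
  induction p with
  | edge e he h1 h2 =>
    exact ⟨_, e, he, h2, by simp, fun g z hg hy => .edge g hg (h1.trans hy.symm) Iff.rfl⟩
  | cons e he h1 h2 ok p ih =>
    obtain ⟨y, f, hf, h3, hy, H⟩ := ih
    exact ⟨y, f, hf, h3, List.mem_cons_of_mem _ hy,
      fun g z hg hy => .cons e he h1 h2 ok (H g z hg hy)⟩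

end Conn

/-! ### Weakly connecting walks -/

/-- The nodes of `C`, their ancestors, and the ribbon core. -/
def Good (G : LMG V E) (C : Set V) : Set V :=
  {x | ∃ c ∈ C, ReflTransGen G.Arrow x c} ∪ G.RibbonCore

theorem mem_union_anSet {C : Set V} {x : V} :
    x ∈ C ∪ G.anSet C ↔ ∃ c ∈ C, ReflTransGen G.Arrow x c := by
  constructor
  · rintro (h | h)
    · exact ⟨x, h, .refl⟩
    · simp only [anSet, Set.mem_iUnion] at h
      obtain ⟨c, hc, _, h⟩ := h
      exact ⟨c, hc, h.to_reflTransGen⟩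
  · rintro ⟨c, hc, h⟩
    by_cases hxc : x = c
    · exact .inl (hxc ▸ hc)
    · refine .inr (Set.mem_biUnion hc ⟨hxc, ?_⟩)
      rcases reflTransGen_iff_eq_or_transGen.1 h with h | h
      · exact (hxc h.symm).elim
      · exact h

theorem subset_good {C : Set V} : C ⊆ G.Good C := fun x hx => .inl ⟨x, hx, .refl⟩

theorem good_mono {C C' : Set V} (h : C ⊆ C') : G.Good C ⊆ G.Good C' := by
  rintro x (⟨c, hc, hx⟩ | hx)
  · exact .inl ⟨c, h hc, hx⟩
  · exact .inr hx

theorem good_of_reach {C : Set V} {x y : V} (h : ReflTransGen G.Arrow x y) (hy : y ∈ G.Good C) :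
    x ∈ G.Good C := by
  rcases hy with ⟨c, hc, hy⟩ | hy
  · exact .inl ⟨c, hc, h.trans hy⟩
  · exact .inr (ribbonCore_of_reach h hy)

/-- Follow the walk out of `a` along its tail: it stays directed until it meets a line or a
collider, both of which put `a` in `Good`, or arrives at `b`. -/
theorem Conn.good_or_reach {C : Set V} {l : List V} {a b : V} {ha hb : Prop}
    (p : G.Conn (G.Good C) C l a ha b hb) (h : ¬ ha) : a ∈ G.Good C ∨ TransGen G.Arrow a b := by
  induction p with
  | @edge a b ha hb e he h1 h2 =>
    by_cases hb' : b ∈ G.head e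
    · exact .inr (.single (arrow_of_head he (fun h' => h (h1.2 h')) hb'))
    · exact .inl (.inr (LineAnc.of_line (line_of_head he (fun h' => h (h1.2 h')) hb')).ribbonCore)
  | @cons a b c ha h₁ h' hc l e he h1 h2 ok p ih =>
    by_cases hb' : b ∈ G.head e
    · have har := arrow_of_head he (fun h' => h (h1.2 h')) hb'
      by_cases hh : h'
      · exact .inl (good_of_reach (.single har) (ok.1 ⟨h2.2 hb', hh⟩))
      · rcases ih hh with ih | ih
        · exact .inl (good_of_reach (.single har) ih)
        · exact .inr (.head har ih)
    · exact .inl (.inr (LineAnc.of_line (line_of_head he (fun h' => h (h1.2 h')) hb')).ribbonCore)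

/-- A closed detour in a weakly connecting walk may be cut out. -/
theorem Conn.cut {C : Set V} {l₁ l₂ l₃ : List V} {a b x : V} {ha hb : Prop}
    (p : G.Conn (G.Good C) C (l₁ ++ x :: (l₂ ++ x :: l₃)) a ha b hb) :
    G.Conn (G.Good C) C (l₁ ++ x :: l₃) a ha b hb := by
  obtain ⟨h1, h2, p1, ok1, p2⟩ := p.split
  obtain ⟨h3, h4, p3, ok2, p4⟩ := p2.split
  refine p1.append ⟨fun hh => ?_, fun hh => ?_⟩ p4
  · by_cases hh2 : h2
    · exact ok1.1 ⟨hh.1, hh2⟩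
    · rcases p3.good_or_reach hh2 with h | h
      · exact h
      · exact .inr (ribbonCore_of_cycle h)
  · by_cases hh1 : h1
    · exact ok2.2 fun h => hh ⟨hh1, h.2⟩
    · exact ok1.2 fun h => hh1 h.1

/-- A collider in the ribbon core between distinct neighbours may be bypassed. -/
theorem Conn.bypass (hG : G.Ribbonless) {D C : Set V} {l₁ l₂ : List V} {a b x : V} {ha hb : Prop}
    (p : G.Conn D C l₁ a ha x True) (q : G.Conn D C l₂ x True b hb) (hx : x ∈ G.RibbonCore)
    (hd : ∀ y ∈ a :: l₁, ∀ z ∈ l₂ ++ [b], y ≠ z) :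
    ∃ hb', G.Conn D C (l₁ ++ l₂) a ha b hb' := by
  obtain ⟨y, e, he, h1, hy, H⟩ := p.exists_last
  cases q with
  | edge f hf h2 h3 =>
    obtain ⟨g, hg, hg1, hg2⟩ := hG.shortcut he hf (hd y hy b (by simp)) (h1.1 trivial)
      (h2.1 trivial) hx
    exact ⟨_, by simpa using H g b hg hg1⟩
  | @cons _ z _ _ h h' _ l f hf h2 h3 ok q =>
    obtain ⟨g, hg, hg1, hg2⟩ := hG.shortcut he hf (hd y hy z (by simp)) (h1.1 trivial)
      (h2.1 trivial) hx
    refine ⟨hb, (H g z hg hg1).append ?_ q⟩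
    rwa [hg2, ← h3]

/-- In a ribbonless graph, a weakly connecting walk may be replaced by one without repeated nodes
and with no collider in the ribbon core. -/
theorem Conn.exists_path (hG : G.Ribbonless) {C : Set V} {l : List V} {a b : V} {ha hb : Prop}
    (hab : a ≠ b) (p : G.Conn (G.Good C) C l a ha b hb) :
    ∃ l' ha' hb', (a :: (l' ++ [b])).Nodup ∧
      G.Conn (G.Good C \ G.RibbonCore) C l' a ha' b hb' := by
  classical
  -- The minimum is over all arrowhead marks at the ends, since cutting the walk at `a` or `b`, or
  -- bypassing a collider, may change them.
  have hex : ∃ n, ∃ l ha hb, l.length = n ∧ G.Conn (G.Good C) C l a ha b hb :=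
    ⟨_, l, ha, hb, rfl, p⟩
  obtain ⟨l, ha, hb, hn, p⟩ := Nat.find_spec hex
  have hmin : ∀ l' ha' hb', G.Conn (G.Good C) C l' a ha' b hb' → l.length ≤ l'.length :=
    fun l' ha' hb' q => hn ▸ Nat.find_min' hex ⟨l', ha', hb', rfl, q⟩
  have hal : a ∉ l := by
    intro h
    obtain ⟨l₁, l₂, rfl⟩ := List.append_of_mem h
    obtain ⟨_, h', _, _, q⟩ := p.split
    have := hmin _ _ _ q
    simp at this
    omega
  have hbl : b ∉ l := by
    intro h
    obtain ⟨l₁, l₂, rfl⟩ := List.append_of_mem h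
    obtain ⟨h, _, q, _, _⟩ := p.split
    have := hmin _ _ _ q
    simp at this
  have hl : l.Nodup := by
    by_contra h
    rw [← List.exists_duplicate_iff_not_nodup] at h
    obtain ⟨x, hx⟩ := h
    obtain ⟨l₁, l', rfl, hx'⟩ : ∃ l₁ l', l = l₁ ++ x :: l' ∧ x ∈ l' := by
      clear hmin hn p hal hbl
      induction hx with
      | cons_mem h => exact ⟨[], _, rfl, h⟩
      | cons_duplicate _ ih =>
        obtain ⟨l₁, l', h, h'⟩ := ih
        exact ⟨_ :: l₁, l', by rw [h]; rfl, h'⟩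
    obtain ⟨l₂, l₃, rfl⟩ := List.append_of_mem hx'
    have := hmin _ _ _ p.cut
    simp at this
    omega
  have hnd : (a :: (l ++ [b])).Nodup := by
    simp [List.nodup_append, hal, hl, hab]
    exact fun x hx h => hbl (h ▸ hx)
  refine ⟨l, ha, hb, hnd, p.upgrade fun l₁ x l₂ hl' hx q q' => ⟨hx, fun hxk => ?_⟩⟩
  subst hl'
  have hd : ∀ y ∈ a :: l₁, ∀ z ∈ l₂ ++ [b], y ≠ z := by
    rintro y hy z hz rfl
    have : (a :: l₁ ++ x :: (l₂ ++ [b])).Nodup := by simpa using hnd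
    rw [List.nodup_append] at this
    exact this.2.2 y hy y (by simp [hz]) rfl
  obtain ⟨hb', r⟩ := q.bypass hG q' hxk hd
  have := hmin _ _ _ r
  simp at this

/-! ### Connecting walks and m-separation -/

theorem Walk.mem_nodes_of_mem_edges {a b : V} (p : G.Walk a b) {e : E} (he : e ∈ p.edges) {x : V}
    (hx : x ∈ G.ends e) : x ∈ p.nodes := by
  induction p with
  | nil a => simp [Walk.edges] at he
  | @cons a b c f h p ih =>
    simp only [Walk.edges, List.mem_cons] at he
    rcases he with rfl | he
    · rw [h, Sym2.mem_iff] at hx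
      rcases hx with rfl | rfl
      · simp [Walk.nodes]
      · cases p <;> simp [Walk.nodes]
    · simp [Walk.nodes, ih he]

theorem Walk.isPath_of_nodup {a b : V} (p : G.Walk a b) (h : p.nodes.Nodup) : p.IsPath := by
  refine ⟨h, ?_⟩
  induction p with
  | nil a => simp [Walk.edges]
  | @cons a b c f hf p ih =>
    simp only [Walk.nodes, List.nodup_cons] at h
    simp only [Walk.edges, List.nodup_cons]
    exact ⟨fun hfp => h.1 (p.mem_nodes_of_mem_edges hfp (by simp [hf])), ih h.2⟩

/-- A walk whose inner nodes pass gives a connecting walk. -/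
theorem Walk.conn {D C : Set V} {a b c : V} (e : E) (he : G.ends e = s(a, b)) (p : G.Walk b c)
    (h : ∀ e' t f, (e', t, f) ∈ (Walk.cons e he p).tripaths →
      (G.Collider e' t f → t ∈ D) ∧ (¬ G.Collider e' t f → t ∉ C)) :
    ∃ l hc, G.Conn D C l a (a ∈ G.head e) c hc := by
  induction p generalizing a e with
  | nil b => exact ⟨[], _, .edge e he Iff.rfl Iff.rfl⟩
  | @cons b d c f hf p ih =>
    obtain ⟨l, hc, q⟩ := ih f hf fun e' t f' ht => h e' t f' (by simp [Walk.tripaths, ht])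
    exact ⟨_, _, .cons e he Iff.rfl Iff.rfl (h e b f (by simp [Walk.tripaths])) q⟩

theorem Conn.exists_walk {D C : Set V} {l : List V} {a b : V} {ha hb : Prop}
    (p : G.Conn D C l a ha b hb) :
    ∃ (c : V) (e : E) (he : G.ends e = s(a, c)) (q : G.Walk c b), (ha ↔ a ∈ G.head e) ∧
      (Walk.cons e he q).nodes = a :: (l ++ [b]) ∧
      ∀ e' t f, (e', t, f) ∈ (Walk.cons e he q).tripaths →
        (G.Collider e' t f → t ∈ D) ∧ (¬ G.Collider e' t f → t ∉ C) := by
  induction p with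
  | @edge a b ha hb e he h1 h2 =>
    exact ⟨b, e, he, .nil b, h1, rfl, fun e' t f ht => by simp [Walk.tripaths] at ht⟩
  | @cons a b c ha h h' hc l e he h1 h2 ok p ih =>
    obtain ⟨d, f, hf, q, h3, h4, h5⟩ := ih
    refine ⟨b, e, he, .cons f hf q, h1, ?_, fun e' t f' ht => ?_⟩
    · rw [Walk.nodes, h4]
      rfl
    · simp only [Walk.tripaths, List.mem_cons, Prod.mk.injEq] at ht
      rcases ht with ⟨rfl, rfl, rfl⟩ | ht
      · simpa [Passes, Collider, ← h2, ← h3] using ok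
      · exact h5 e' t f' ht

theorem Conn.exists_mConnecting {C : Set V} {l : List V} {a b : V} {ha hb : Prop}
    (p : G.Conn (C ∪ G.anSet C) C l a ha b hb) (hl : (a :: (l ++ [b])).Nodup) :
    ∃ q : G.Walk a b, G.MConnecting C q := by
  obtain ⟨c, e, he, r, -, hr, hr'⟩ := p.exists_walk
  exact ⟨_, (Walk.cons e he r).isPath_of_nodup (hr ▸ hl), hr'⟩

theorem MConnecting.exists_conn {C : Set V} {a b : V} {p : G.Walk a b} (hab : a ≠ b)
    (h : G.MConnecting C p) : ∃ l ha hb, G.Conn (C ∪ G.anSet C) C l a ha b hb := by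
  cases p with
  | nil => exact (hab rfl).elim
  | cons e he p =>
    obtain ⟨l, hb, q⟩ := Walk.conn e he p h.2
    exact ⟨_, _, _, q⟩

/-- There is a weakly connecting walk between `a` and `b` given `C`. -/
def Linked (G : LMG V E) (C : Set V) (a b : V) : Prop :=
  ∃ l ha hb, G.Conn (G.Good C) C l a ha b hb

theorem Linked.symm {C : Set V} {a b : V} (h : G.Linked C a b) : G.Linked C b a := by
  obtain ⟨l, ha, hb, p⟩ := h
  exact ⟨_, _, _, p.reverse⟩

/-- In a ribbonless graph, m-separation means that there are no weakly connecting walks. -/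
theorem mSep_iff (hG : G.Ribbonless) {A B C : Set V} (hAB : Disjoint A B) :
    G.MSep A B C ↔ ∀ a ∈ A, ∀ b ∈ B, ¬ G.Linked C a b := by
  constructor
  · rintro h a ha b hb ⟨l, h1, h2, p⟩
    obtain ⟨l', h1', h2', hnd, q⟩ := p.exists_path hG (hAB.ne_of_mem ha hb)
    obtain ⟨r, hr⟩ := (q.mono (D' := C ∪ G.anSet C) (C' := C) (fun x _ hx =>
      mem_union_anSet.2 (hx.1.resolve_right hx.2)) fun _ _ => id).exists_mConnecting hnd
    exact h a ha b hb r hr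
  · rintro h a ha b hb p hp
    obtain ⟨l, h1, h2, q⟩ := hp.exists_conn (hAB.ne_of_mem ha hb)
    exact h a ha b hb ⟨l, h1, h2, q.mono (fun x _ hx => .inl (mem_union_anSet.1 hx)) fun _ _ => id⟩

/-! ### Anteriors -/

/-- Removal travels up directed paths: a line at `y` turns every arrow into `y` into a line, which
then acts on its source in the same way. -/
theorem headRemoved_iff {e : E} {x : V} : G.HeadRemoved e x ↔ x ∈ G.head e ∧ G.LineAnc x := by
  constructor
  · intro h
    induction h with
    | step e f x he hf _ ih =>
      refine ⟨he, ?_⟩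
      by_cases hx : x ∈ G.head f
      · exact (ih x hx).2
      · obtain ⟨z, hz⟩ := hf
        by_cases hz' : z ∈ G.head f
        · exact .of_tail hz hx (ih z hz').2
        · exact .of_line (line_of_head hz hx hz')
  · rintro ⟨he, y, hxy, l, hl⟩
    induction hxy using ReflTransGen.head_induction_on generalizing e with
    | refl =>
      obtain ⟨f, hf, hf'⟩ := hl
      exact .step e f _ he (by simp [hf]) (by simp [hf'])
    | @head x w hxw _ ih =>
      obtain ⟨f, hf, hf'⟩ := hxw
      refine .step e f _ he (by simp [hf]) fun z hz => ?_
      have hzw : z = w := by simpa [hf'] using hz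
      subst hzw
      exact ih hz

theorem mem_anterior_head {e : E} {x : V} :
    x ∈ G.anterior.head e ↔ x ∈ G.head e ∧ ¬ G.LineAnc x := by
  simp only [anterior, headRemoved_iff, Set.mem_ofPred_eq]
  tauto

/-- In the anterior graph, some edge between `x` and `y` has no arrowhead at `x`. -/
def AntStep (G : LMG V E) (x y : V) : Prop :=
  ∃ e, G.ends e = s(x, y) ∧ (x ∉ G.head e ∨ G.LineAnc x)

theorem antStep_iff {x y : V} :
    G.AntStep x y ↔ ∃ e, G.anterior.ends e = s(x, y) ∧ x ∉ G.anterior.head e := by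
  simp only [mem_anterior_head, AntStep, not_and, not_not, imp_iff_not_or]
  rfl

theorem Arrow.antStep {x y : V} (h : G.Arrow x y) : G.AntStep x y := by
  obtain ⟨e, h1, h2, -⟩ := h.exists_edge
  exact ⟨e, h1, .inl h2⟩

theorem reach_of_directed {x y : V} (h : ReflTransGen G.Arrow x y) :
    ReflTransGen G.AntStep x y :=
  ReflTransGen.mono (fun _ _ h => h.antStep) _ _ h

/-- With no line at or below `x`, no arrowhead met on the way down is ever removed, so each step is
an arrow of `G` itself. -/
theorem directed_of_reach {x y : V} (h : ReflTransGen G.AntStep x y) (hx : ¬ G.LineAnc x) :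
    ReflTransGen G.Arrow x y := by
  induction h using ReflTransGen.head_induction_on with
  | refl => exact .refl
  | @head x w hxw _ ih =>
    obtain ⟨e, he, h⟩ := hxw
    have hxe := h.resolve_right hx
    have har : G.Arrow x w := by
      refine arrow_of_head he hxe ?_
      by_contra hw
      exact hx (.of_line (line_of_head he hxe hw))
    exact .head har (ih fun h => hx (h.of_arrow har))

theorem lineAnc_of_anterior_line {x y : V} (h : G.anterior.Line x y) : G.LineAnc x := by
  obtain ⟨e, he, h1, h2⟩ := h.exists_edge
  have he' : G.ends e = s(x, y) := he
  rw [mem_anterior_head] at h1 h2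
  by_cases hx : x ∈ G.head e
  · by_contra hx'
    exact h1 ⟨hx, hx'⟩
  · by_cases hy : y ∈ G.head e
    · refine .of_tail he' hx ?_
      by_contra hy'
      exact h2 ⟨hy, hy'⟩
    · exact .of_line (line_of_head he' hx hy)

/-- The order "lines before arrows" is automatic: in `G*` no arrowhead points to an endpoint of a
line, so no line can follow an arrow. -/
theorem mem_ant_iff {i j : V} : i ∈ G.ant j ↔ i ≠ j ∧ ReflTransGen G.AntStep i j := by
  simp only [ant, Set.mem_ofPred_eq, and_congr_right_iff]
  intro hij
  clear hij
  constructor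
  · rintro ⟨m, h1, h2⟩
    refine (ReflTransGen.mono (fun x y h => ?_) _ _ h1).trans
      (ReflTransGen.mono (fun x y h => ?_) _ _ h2)
    · obtain ⟨e, h1, h2, -⟩ := h.exists_edge
      exact antStep_iff.2 ⟨e, h1, h2⟩
    · obtain ⟨e, h1, h2, -⟩ := h.exists_edge
      exact antStep_iff.2 ⟨e, h1, h2⟩
  · intro h
    induction h using ReflTransGen.head_induction_on with
    | refl => exact ⟨j, .refl, .refl⟩
    | @head x w hxw _ ih =>
      obtain ⟨e, he, hxe⟩ := antStep_iff.1 hxw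
      obtain ⟨m, h1, h2⟩ := ih
      by_cases hw : w ∈ G.anterior.head e
      · refine ⟨x, .refl, .head (arrow_of_head he hxe hw) ?_⟩
        rcases h1.cases_head with rfl | ⟨z, hz, _⟩
        · exact h2
        · exact ((mem_anterior_head.1 hw).2 (lineAnc_of_anterior_line hz)).elim
      · exact ⟨m, .head (line_of_head he hxe hw) h1, h2⟩

/-- The nodes that are anterior or equal to `i` or `j`. -/
def antPair (G : LMG V E) (i j : V) : Set V :=
  {x | ReflTransGen G.AntStep x i ∨ ReflTransGen G.AntStep x j}

theorem antPair_diff (i j : V) : (G.ant i ∪ G.ant j) \ {i, j} = G.antPair i j \ {i, j} := by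
  ext x
  simp only [antPair, Set.mem_sdiff, Set.mem_union, mem_ant_iff, Set.mem_ofPred_eq,
    Set.mem_insert_iff, Set.mem_singleton_iff]
  tauto

/-- `N` contains all anteriors of its nodes. -/
def AntClosed (G : LMG V E) (N : Set V) : Prop := ∀ x y, G.AntStep x y → y ∈ N → x ∈ N

theorem AntClosed.reach {N : Set V} (hN : G.AntClosed N) {x y : V}
    (h : ReflTransGen G.AntStep x y) (hy : y ∈ N) : x ∈ N := by
  induction h using ReflTransGen.head_induction_on with
  | refl => exact hy
  | head h _ ih => exact hN _ _ h ih

theorem antClosed_antPair (i j : V) : G.AntClosed (G.antPair i j) := by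
  rintro x y h (hy | hy)
  · exact .inl (.head h hy)
  · exact .inr (.head h hy)

/-- Each node is anterior to the next until a collider, which is in `D ⊆ N`, or the end `b` is met.
-/
theorem Conn.mem_of_tail {D C N : Set V} {l : List V} {a b : V} {ha hb : Prop}
    (p : G.Conn D C l a ha b hb) (hN : G.AntClosed N) (hD : D ⊆ N) (hbN : b ∈ N)
    (h : ¬ ha ∨ G.LineAnc a) : a ∈ N := by
  induction p with
  | edge e he h1 h2 => exact hN _ _ ⟨e, he, h.imp_left fun h h' => h (h1.2 h')⟩ hbN
  | @cons a x b ha h₁ h' hb l e he h1 h2 ok p ih =>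
    have hax : G.AntStep a x := ⟨e, he, h.imp_left fun h h' => h (h1.2 h')⟩
    refine hN _ _ hax ?_
    by_cases hc : h₁ ∧ h'
    · exact hD (ok.1 hc)
    · by_cases hh : h'
      · have hx : x ∉ G.head e := fun hx => hc ⟨h2.2 hx, hh⟩
        refine ih hbN (.inr ?_)
        rcases h with h | h
        · exact .of_line (line_of_head he (fun h' => h (h1.2 h')) hx).symm
        · exact .of_tail (ends_symm he) hx h
      · exact ih hbN (.inl hh)

/-- If all inner nodes in the closed set `N` are in `C`, then all inner nodes are colliders. -/
theorem Conn.all_colliders {D C N : Set V} {l : List V} {a b : V} {ha hb : Prop}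
    (p : G.Conn D C l a ha b hb) (hN : G.AntClosed N) (hD : D ⊆ N) (haN : a ∈ N) (hbN : b ∈ N)
    (hl : ∀ x ∈ l, x ∈ N → x ∈ C) : G.Conn D Set.univ l a ha b hb := by
  induction p with
  | edge e he h1 h2 => exact .edge e he h1 h2
  | @cons a x b ha h h' hb l e he h1 h2 ok p ih =>
    -- A non-collider has a tail on one side, and following it shows that the node is in `N`, hence
    -- in `C`. Here and below, `Set.univ` in place of `C` forbids non-colliders.
    have hc : h ∧ h' := by
      by_contra hc
      refine ok.2 hc (hl x (by simp) ?_)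
      by_cases hh : h
      · exact p.mem_of_tail hN hD hbN (.inl fun hh' => hc ⟨hh, hh'⟩)
      · exact hN x a ⟨e, ends_symm he, .inl fun hx => hh (h2.2 hx)⟩ haN
    exact .cons e he h1 h2 ⟨ok.1, fun h => (h hc).elim⟩
      (ih (hD (ok.1 hc)) hbN fun y hy => hl y (by simp [hy]))

/-! ### Maximality -/

/-- No node of the directed path before `z` is good, since `x` would then be good too; so its inner
nodes are non-colliders outside `C`. -/
theorem Conn.of_directed {C : Set V} {x z : V} (h : TransGen G.Arrow x z) (hx : x ∉ G.Good C) :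
    ∃ l, G.Conn (G.Good C) C l x False z True := by
  induction h using TransGen.head_induction_on with
  | @single x h =>
    obtain ⟨e, he, h1, h2⟩ := h.exists_edge
    exact ⟨[], .edge e he (by simp [h1]) (by simp [h2])⟩
  | @head x w h _ ih =>
    obtain ⟨e, he, h1, h2⟩ := h.exists_edge
    have hw : w ∉ G.Good C := fun hw => hx (good_of_reach (.single h) hw)
    obtain ⟨l, p⟩ := ih hw
    exact ⟨_, .cons e he (h := True) (by simp [h1]) (by simp [h2])
      ⟨fun h => h.2.elim, fun _ hwC => hw (subset_good hwC)⟩ p⟩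

theorem Conn.exists_first {D : Set V} {l : List V} {a b : V} {ha hb : Prop}
    (p : G.Conn D Set.univ l a ha b hb) (hab : ¬ G.Adj a b) :
    ∃ e x, G.ends e = s(a, x) ∧ (ha ↔ a ∈ G.head e) ∧ x ∈ G.head e ∧ x ∈ D := by
  cases p with
  | edge e he h1 h2 => exact (hab ⟨e, he⟩).elim
  | @cons _ x _ _ h h' _ l e he h1 h2 ok p =>
    have hc : h ∧ h' := by
      by_contra hc
      exact ok.2 hc trivial
    exact ⟨e, x, he, h1, h2.1 hc.1, ok.1 hc⟩

/-- A primitive inducing path from `y` to `b`, preceded by a weakly connecting walk from `a` to `y`,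
yields a weakly connecting walk from `a` to `b`. -/
theorem Conn.replace {D C : Set V} {a b : V} {ha hb : Prop}
    (hD : ∀ x ∈ D, TransGen G.Arrow x b ∧ hb ∨ TransGen G.Arrow x a ∧ ha)
    {l l₀ : List V} {y : V} {h : Prop} (p : G.Conn D Set.univ l y h b hb) (hh : h)
    (hy : y ∈ D) (q : G.Conn (G.Good C) C l₀ a ha y True) :
    ∃ l', G.Conn (G.Good C) C l' a ha b hb := by
  -- If `y` is not admissible as a collider given `C`, the walk is rerouted: down a directed path
  -- from `y` to `b`, or up the reverse of one from `y` to `a`, which restarts at `a` and makes `y`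
  -- a non-collider. `hD` supplies the right arrowhead at the end reached.
  have pivot : ∀ {y : V} {l₀ : List V}, y ∈ D → G.Conn (G.Good C) C l₀ a ha y True →
      (∃ l', G.Conn (G.Good C) C l' a ha b hb) ∨
        ∃ l' k, G.Conn (G.Good C) C l' a ha y k ∧ Passes (G.Good C) C k y True := by
    intro y l₀ hy q
    by_cases hyg : y ∈ G.Good C
    · exact .inr ⟨l₀, True, q, fun _ => hyg, fun h => by simp at h⟩
    · have hyC : y ∉ C := fun h => hyg (subset_good h)
      rcases hD y hy with ⟨h1, h2⟩ | ⟨h1, h2⟩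
      · obtain ⟨l', r⟩ := Conn.of_directed h1 hyg
        rw [eq_true h2]
        exact .inl ⟨_, q.append ⟨fun h => h.2.elim, fun _ => hyC⟩ r⟩
      · obtain ⟨l', r⟩ := Conn.of_directed h1 hyg
        rw [eq_true h2]
        exact .inr ⟨_, False, r.reverse, fun h => h.1.elim, fun _ => hyC⟩
  induction p generalizing l₀ with
  | edge e he h1 h2 =>
    rcases pivot hy q with h | ⟨l', k, r, ok⟩
    · exact h
    · exact ⟨_, r.append ok (.edge e he (by simp [← h1, hh]) h2)⟩
  | @cons y x b h h₁ h' hb l e he h1 h2 ok p ih =>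
    rcases pivot hy q with h | ⟨l', k, r, ok'⟩
    · exact h
    · have hc : h₁ ∧ h' := by
        by_contra hc
        exact ok.2 hc trivial
      exact ih hD hc.2 (ok.1 hc) (r.append ok' (.edge e he (by simp [← h1, hh])
        (by simp [← h2, hc.1]))) pivot

section AddEdge

variable {a b : V} {hab : a ≠ b} {H : Set V} {hH : H ⊆ {a, b}}

/-- Walks of the extended graph are walks of `G` if the new edge can be replaced. -/
theorem Conn.of_addEdge {D C : Set V}
    (hnew : ∃ l, G.Conn D C l a (a ∈ H) b (b ∈ H)) {l : List V} {x y : V} {hx hy : Prop}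
    (p : (G.addEdge a b hab H hH).Conn D C l x hx y hy) : ∃ l', G.Conn D C l' x hx y hy := by
  have key : ∀ {x y : V} {hx hy : Prop} (e : Option E),
      (G.addEdge a b hab H hH).ends e = s(x, y) →
      (hx ↔ x ∈ (G.addEdge a b hab H hH).head e) → (hy ↔ y ∈ (G.addEdge a b hab H hH).head e) →
      ∃ l', G.Conn D C l' x hx y hy := by
    rintro x y hx hy (_ | e) he h1 h2
    · have he' : s(a, b) = s(x, y) := he
      have h1' : hx = (x ∈ H) := propext h1
      have h2' : hy = (y ∈ H) := propext h2
      obtain ⟨l, q⟩ := hnew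
      rcases Sym2.eq_iff.1 he' with ⟨rfl, rfl⟩ | ⟨rfl, rfl⟩
      · exact ⟨l, h1' ▸ h2' ▸ q⟩
      · exact ⟨_, h1' ▸ h2' ▸ q.reverse⟩
    · exact ⟨[], .edge e he h1 h2⟩
  induction p with
  | edge e he h1 h2 => exact key e he h1 h2
  | cons e he h1 h2 ok p ih =>
    obtain ⟨l₁, q⟩ := key e he h1 h2
    obtain ⟨l₂, r⟩ := ih
    exact ⟨_, q.append ok r⟩

theorem Conn.to_addEdge {D C : Set V} {l : List V} {x y : V} {hx hy : Prop}
    (p : G.Conn D C l x hx y hy) : (G.addEdge a b hab H hH).Conn D C l x hx y hy := by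
  induction p with
  | edge e he h1 h2 => exact .edge (some e) he h1 h2
  | cons e he h1 h2 ok p ih => exact .cons (some e) he h1 h2 ok ih

theorem Arrow.to_addEdge {x y : V} (h : G.Arrow x y) : (G.addEdge a b hab H hH).Arrow x y := by
  obtain ⟨e, h1, h2⟩ := h
  exact ⟨some e, h1, h2⟩

/-- In connecting walks the new edge is replaced by a walk of `G` with the same end marks; a new
arrow parallels a directed path, so ancestors do not change. The extended graph need not be
ribbonless, so weakly connecting walks are reduced to paths only in `G`. -/
theorem indepModel_addEdge (hG : G.Ribbonless)
    (hnew : ∀ C, ∃ l, G.Conn (G.Good C) C l a (a ∈ H) b (b ∈ H))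
    (hab' : a ∉ H → b ∈ H → TransGen G.Arrow a b)
    (hba' : b ∉ H → a ∈ H → TransGen G.Arrow b a) :
    (G.addEdge a b hab H hH).indepModel = G.indepModel := by
  have harr : ∀ {x y}, (G.addEdge a b hab H hH).Arrow x y → TransGen G.Arrow x y := by
    intro x y h
    obtain ⟨_ | e, h1, h2, h3⟩ := h.exists_edge
    · have h1' : s(a, b) = s(x, y) := h1
      rcases Sym2.eq_iff.1 h1' with ⟨rfl, rfl⟩ | ⟨rfl, rfl⟩
      · exact hab' h2 h3
      · exact hba' h2 h3
    · exact .single (arrow_of_head h1 h2 h3)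
  have hreach : ∀ {x y}, ReflTransGen (G.addEdge a b hab H hH).Arrow x y →
      ReflTransGen G.Arrow x y := by
    intro x y h
    induction h with
    | refl => exact .refl
    | tail _ h ih => exact ih.trans (harr h).to_reflTransGen
  have hsep : ∀ A B C : Set V, Disjoint A B →
      ((G.addEdge a b hab H hH).MSep A B C ↔ G.MSep A B C) := by
    intro A B C hAB
    rw [mSep_iff hG hAB]
    constructor
    · rintro h x hx y hy ⟨l, _, _, p⟩
      obtain ⟨l', _, _, hl', q⟩ := p.exists_path hG (hAB.ne_of_mem hx hy)
      have hgood : ∀ z ∈ l', z ∈ G.Good C \ G.RibbonCore →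
          z ∈ C ∪ (G.addEdge a b hab H hH).anSet C := by
        intro z _ hz
        obtain ⟨c, hc, hz⟩ := hz.1.resolve_right hz.2
        exact mem_union_anSet.2 ⟨c, hc, ReflTransGen.mono (fun _ _ h => h.to_addEdge) _ _ hz⟩
      obtain ⟨r, hr⟩ := ((q.mono hgood fun _ _ => id).to_addEdge
        (hab := hab) (hH := hH)).exists_mConnecting hl'
      exact h x hx y hy r hr
    · intro h x hx y hy p hp
      obtain ⟨l, _, _, q⟩ := hp.exists_conn (hAB.ne_of_mem hx hy)
      obtain ⟨l', q'⟩ := Conn.of_addEdge (hnew C) (q.mono (D' := G.Good C) (C' := C)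
        (fun z _ hz => by
          obtain ⟨c, hc, hz⟩ := mem_union_anSet.1 hz
          exact .inl ⟨c, hc, hreach hz⟩) fun _ _ => id)
      exact h x hx y hy ⟨_, _, _, q'⟩
  ext ⟨A, B, C⟩
  exact and_congr_right fun h => hsep A B C h.1

end AddEdge

/-- In a maximal ribbonless graph, non-adjacent nodes are separated by their anteriors. -/
theorem Maximal.not_linked (hG : G.Ribbonless) (hmax : G.Maximal) {a b : V} (hab : a ≠ b)
    (hadj : ¬ G.Adj a b) : ¬ G.Linked (G.antPair a b \ {a, b}) a b := by
  rintro ⟨l₀, _, _, p₀⟩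
  obtain ⟨l, ha, hb, hl, p⟩ := p₀.exists_path hG hab
  have hN := G.antClosed_antPair a b
  have hal : a ∉ l := by
    simp only [List.nodup_cons, List.mem_append, not_or] at hl
    exact hl.1.1
  have hbl : b ∉ l := by
    simp only [List.nodup_cons, List.nodup_append] at hl
    exact fun h => hl.2.2.2 b h b (by simp) rfl
  replace p := p.all_colliders hN (fun x hx => ?_) (.inl .refl) (.inr .refl)
    fun x hx hxN => ⟨hxN, by rintro (rfl | rfl) <;> contradiction⟩
  swap
  · obtain ⟨c, hc, hxc⟩ := hx.1.resolve_right hx.2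
    exact hN.reach (reach_of_directed hxc) hc.1
  set D : Set V := {x | x ∉ G.RibbonCore ∧ (TransGen G.Arrow x a ∨ TransGen G.Arrow x b)} with hDdef
  replace p : G.Conn D Set.univ l a ha b hb := by
    refine p.mono (fun x hx hxD => ⟨hxD.2, ?_⟩) fun _ _ => id
    obtain ⟨c, hc, hxc⟩ := hxD.1.resolve_right hxD.2
    -- Off the ribbon core there is no line below `x`, so anterior paths from `x` are directed.
    have hxL : ¬ G.LineAnc x := fun h => hxD.2 h.ribbonCore
    have hx' : ∀ d, d ∉ l → ReflTransGen G.AntStep c d → TransGen G.Arrow x d := by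
      intro d hd hcd
      rcases reflTransGen_iff_eq_or_transGen.1
        (directed_of_reach ((reach_of_directed hxc).trans hcd) hxL) with rfl | h
      · exact (hd hx).elim
      · exact h
    exact hc.1.imp (hx' a hal) (hx' b hbl)
  have hadj' : ¬ G.Adj b a := fun ⟨e, he⟩ => hadj ⟨e, ends_symm he⟩
  have hcyc : ∀ {x y}, x ∈ D → TransGen G.Arrow x y → G.Arrow y x → False := fun hx h h' =>
    hx.1 (ribbonCore_of_cycle (h.tail h'))
  -- With a tail at `a`, the first collider is a child of `a`; being off every directed cycle it is
  -- no ancestor of `a`, hence one of `b`.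
  have h1 : ¬ ha → TransGen G.Arrow a b := by
    intro h
    obtain ⟨e, x, he, h1, h2, hx⟩ := p.exists_first hadj
    have har := arrow_of_head he (fun h' => h (h1.2 h')) h2
    exact .head har (hx.2.resolve_left fun h => hcyc hx h har)
  have h2 : ¬ hb → TransGen G.Arrow b a := by
    intro h
    obtain ⟨e, x, he, h1, h2, hx⟩ := p.reverse.exists_first hadj'
    have har := arrow_of_head he (fun h' => h (h1.2 h')) h2
    exact .head har (hx.2.resolve_right fun h => hcyc hx h har)
  -- Tails at both ends would make `a` and `b` ancestors of each other, and the colliders would lie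
  -- above a directed cycle.
  have h3 : ha ∨ hb := by
    by_contra hh
    rw [not_or] at hh
    obtain ⟨e, x, he, -, -, hx⟩ := p.exists_first hadj
    have haa := (h1 hh.1).trans (h2 hh.2)
    refine hx.1 (ribbonCore_of_reach ?_ (ribbonCore_of_cycle haa))
    rcases hx.2 with h | h
    · exact h.to_reflTransGen
    · exact (h.trans (h2 hh.2)).to_reflTransGen
  have h4 : ∀ x ∈ D, TransGen G.Arrow x b ∧ hb ∨ TransGen G.Arrow x a ∧ ha := by
    rintro x ⟨-, hx | hx⟩
    · by_cases hha : ha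
      · exact .inr ⟨hx, hha⟩
      · exact .inl ⟨hx.trans (h1 hha), h3.resolve_left hha⟩
    · by_cases hhb : hb
      · exact .inl ⟨hx, hhb⟩
      · exact .inr ⟨hx.trans (h2 hhb), h3.resolve_right hhb⟩
  let H : Set V := {x | x = a ∧ ha ∨ x = b ∧ hb}
  have hHa : (a ∈ H) = ha := by simp [H, hab]
  have hHb : (b ∈ H) = hb := by simp [H, hab.symm]
  have hH : H ⊆ {a, b} := by
    rintro x (⟨rfl, -⟩ | ⟨rfl, -⟩) <;> simp
  refine hmax a b hab H hH hadj (indepModel_addEdge hG (fun C => ?_) ?_ ?_)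
  · rw [hHa, hHb]
    cases p with
    | edge e he _ _ => exact (hadj ⟨e, he⟩).elim
    | @cons _ x _ _ h h' _ l e he h5 h6 ok p =>
      have hc : h ∧ h' := by
        by_contra hc
        exact ok.2 hc trivial
      exact p.replace h4 hc.2 (ok.1 hc) (.edge e he h5 (by simp [← h6, hc.1]))
  · rw [hHa, hHb]
    exact fun h _ => h1 h
  · rw [hHa, hHb]
    exact fun h _ => h2 h

end LMG

/-! ### Consequences of intersection, composition and the semigraphoid axioms -/

namespace IndependenceModel

variable {V : Type u} {J : IndependenceModel V} {A B C M N T T' : Set V} {a b : V}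

theorem indep_of_forall_intersection [Finite V] (hI : J.Intersection) (hAB : Disjoint A B) (hB : B ⊆ M)
    (h : ∀ b ∈ B, J.Indep A {b} (M \ (A ∪ {b}))) : J.Indep A B (M \ (A ∪ B)) := by
  induction B, B.toFinite using Set.Finite.induction_on with
  | empty =>
    exact J.empty_right' _ _ (Set.disjoint_left.2 fun x hx hx' => hx'.2 (.inl hx))
  | @insert b B hb _ ih =>
    rw [Set.disjoint_insert_right] at hAB
    rw [Set.insert_subset_iff] at hB
    have h1 := h b (by simp)
    have h2 := ih hAB.2 hB.2 fun c hc => h c (by simp [hc])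
    have hAB' := Set.disjoint_left.1 hAB.2
    have e1 : M \ (A ∪ {b}) = M \ (A ∪ insert b B) ∪ B := by
      ext x
      have := @hAB' x
      have := @hB.2 x
      have : x ∈ B → x ≠ b := fun h h' => hb (h' ▸ h)
      simp only [Set.mem_sdiff, Set.mem_union, Set.mem_insert_iff, Set.mem_singleton_iff]
      tauto
    have e2 : M \ (A ∪ B) = M \ (A ∪ insert b B) ∪ {b} := by
      ext x
      have : x = b → x ∈ M ∧ x ∉ A ∧ x ∉ B := by
        rintro rfl
        exact ⟨hB.1, hAB.1, hb⟩
      simp only [Set.mem_sdiff, Set.mem_union, Set.mem_insert_iff, Set.mem_singleton_iff]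
      tauto
    rw [e1] at h1
    rw [e2] at h2
    have := hI A {b} (M \ (A ∪ insert b B)) B (Set.disjoint_singleton_right.2 hAB.1)
      (Set.disjoint_left.2 fun x hx hx' => hx'.2 (.inl hx)) hAB.2
      (Set.disjoint_singleton_left.2 fun h => h.2 (.inr (by simp)))
      (Set.disjoint_singleton_left.2 hb)
      (Set.disjoint_left.2 fun x hx hx' => hx.2 (.inr (by simp [hx']))) h1 h2
    rwa [Set.singleton_union] at this

theorem indep_of_forall_composition [Finite V] (hC : J.Composition) (hAC : Disjoint A C)
    (h : ∀ b ∈ B, J.Indep A {b} C) : J.Indep A B C := by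
  induction B, B.toFinite using Set.Finite.induction_on with
  | empty => exact J.empty_right' _ _ hAC
  | @insert b B hb _ ih =>
    have h1 := h b (by simp)
    have h2 := ih fun c hc => h c (by simp [hc])
    obtain ⟨d1, -, d2⟩ := J.disjoint' _ _ _ h1
    obtain ⟨d3, -, d4⟩ := J.disjoint' _ _ _ h2
    have := hC A {b} C B d1 hAC d3 d2 (Set.disjoint_singleton_left.2 hb) d4.symm h1 h2
    rwa [Set.singleton_union] at this

/-- `a` and `b` are independent given all other nodes of `N`. -/
def IndepRest (J : IndependenceModel V) (N : Set V) (a b : V) : Prop :=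
  J.Indep {a} {b} (N \ {a, b})

theorem IsSemigraphoid.indepRest_symm (hJ : J.IsSemigraphoid) (h : J.IndepRest N a b) :
    J.IndepRest N b a := by
  unfold IndepRest at h ⊢
  rw [Set.pair_comm]
  exact hJ.symm h

theorem indep_set [Finite V] (hI : J.Intersection)
    (hT : T ⊆ N) (haT : a ∉ T) (h : ∀ t ∈ T, J.IndepRest N a t) :
    J.Indep {a} T (N \ ({a} ∪ T)) :=
  indep_of_forall_intersection hI (Set.disjoint_singleton_left.2 haT) hT h

/-- Intersection makes `a` independent of `T` as a whole, contraction joins this with the statement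
over `N \ T`, and weak union moves `T` into the conditioning set. -/
theorem IsSemigraphoid.indepRest_of_diff [Finite V] (hJ : J.IsSemigraphoid) (hI : J.Intersection)
    (hT : T ⊆ N) (haT : a ∉ T) (hb : b ∈ N) (hbT : b ∉ T) (hab : a ≠ b)
    (h : J.IndepRest (N \ T) a b) (h' : ∀ t ∈ T, J.IndepRest N a t) : J.IndepRest N a b := by
  have h1 := indep_set hI hT haT h'
  have e1 : N \ ({a} ∪ T) = {b} ∪ (N \ T) \ {a, b} := by
    ext x
    have : x = b → x ∈ N ∧ x ∉ T ∧ x ≠ a := by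
      rintro rfl
      exact ⟨hb, hbT, hab.symm⟩
    simp only [Set.mem_sdiff, Set.mem_union, Set.mem_insert_iff, Set.mem_singleton_iff]
    tauto
  rw [e1] at h1
  have h2 := hJ.weakUnion (Set.disjoint_singleton_left.2 hbT) (hJ.contraction h h1)
  have e2 : (N \ T) \ {a, b} ∪ T = N \ {a, b} := by
    ext x
    have : x ∈ T → x ∈ N ∧ x ≠ a ∧ x ≠ b := fun hx =>
      ⟨hT hx, fun h => haT (h ▸ hx), fun h => hbT (h ▸ hx)⟩
    simp only [Set.mem_sdiff, Set.mem_union, Set.mem_insert_iff, Set.mem_singleton_iff]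
    tauto
  rwa [e2] at h2

/-- Intersection, applied in `N \ T'` and in `N \ T`, gives independence of `a` from `T` and from
`T'` given the same set, the rest of `N`. Composition joins the two, and weak union isolates `t`. -/
theorem IsSemigraphoid.indepRest_of_two [Finite V] (hJ : J.IsSemigraphoid) (hI : J.Intersection)
    (hC : J.Composition) (hT : T ⊆ N) (hT' : T' ⊆ N) (hTT' : Disjoint T T') (haT : a ∉ T)
    (haT' : a ∉ T') (h : ∀ t ∈ T, J.IndepRest (N \ T') a t)
    (h' : ∀ t ∈ T', J.IndepRest (N \ T) a t) {t : V} (ht : t ∈ T) : J.IndepRest N a t := by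
  have hd := Set.disjoint_left.1 hTT'
  have h1 := indep_set hI (N := N \ T') (T := T) (fun x hx => ⟨hT hx, hd hx⟩) haT h
  have h2 := indep_set hI (N := N \ T) (T := T') (fun x hx => ⟨hT' hx, fun h => hd h hx⟩) haT' h'
  have e : (N \ T) \ ({a} ∪ T') = (N \ T') \ ({a} ∪ T) := by
    ext x
    simp only [Set.mem_sdiff, Set.mem_union, Set.mem_singleton_iff]
    tauto
  rw [e] at h2
  obtain ⟨d1, d2, d3⟩ := J.disjoint' _ _ _ h1
  obtain ⟨d4, -, d5⟩ := J.disjoint' _ _ _ h2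
  have h3 := hC _ _ _ _ d1 d2 d4 d3 hTT' d5.symm h1 h2
  have e1 : T ∪ T' = {t} ∪ (T \ {t} ∪ T') := by
    rw [← Set.union_assoc, Set.singleton_union, Set.insert_sdiff_singleton, Set.insert_eq_of_mem ht]
  rw [e1] at h3
  have h4 := hJ.weakUnion (Set.disjoint_singleton_left.2 fun hx =>
    hx.elim (fun h => h.2 rfl) fun h => hd ht h) h3
  have e2 : (N \ T') \ ({a} ∪ T) ∪ (T \ {t} ∪ T') = N \ {a, t} := by
    ext x
    have : x ∈ T → x ∈ N ∧ x ≠ a := fun hx => ⟨hT hx, fun h => haT (h ▸ hx)⟩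
    have : x ∈ T' → x ∈ N ∧ x ≠ a ∧ x ≠ t := fun hx =>
      ⟨hT' hx, fun h => haT' (h ▸ hx), fun h => hd ht (h ▸ hx)⟩
    have : x = t → x ∈ T := fun h => h ▸ ht
    simp only [Set.mem_sdiff, Set.mem_union, Set.mem_insert_iff, Set.mem_singleton_iff]
    tauto
  rwa [e2] at h4

end IndependenceModel

namespace LMG

open Relation

variable {V : Type u} {E : Type v} {G : LMG V E} {N T T' : Set V}

/-! ### Sink classes of anterior sets -/

/-- `T` is a maximal class of mutually anterior nodes of `N`. -/
def IsSink (G : LMG V E) (N T : Set V) : Prop :=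
  ∃ t ∈ N, (∀ x ∈ N, ReflTransGen G.AntStep t x → ReflTransGen G.AntStep x t) ∧
    T = {x | ReflTransGen G.AntStep x t ∧ ReflTransGen G.AntStep t x}

theorem IsSink.subset (hT : G.IsSink N T) (hN : G.AntClosed N) : T ⊆ N := by
  obtain ⟨t, ht, -, rfl⟩ := hT
  exact fun x hx => hN.reach hx.1 ht

theorem IsSink.nonempty (hT : G.IsSink N T) : T.Nonempty := by
  obtain ⟨t, ht, -, rfl⟩ := hT
  exact ⟨t, .refl, .refl⟩

theorem IsSink.reach (hT : G.IsSink N T) {x y : V} (hx : x ∈ T) (hy : y ∈ T) :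
    ReflTransGen G.AntStep x y := by
  obtain ⟨t, ht, -, rfl⟩ := hT
  exact hx.1.trans hy.2

theorem IsSink.mem_of_reach (hT : G.IsSink N T) {x y : V} (hx : x ∈ T) (hy : y ∈ N)
    (h : ReflTransGen G.AntStep x y) : y ∈ T := by
  obtain ⟨t, ht, h', rfl⟩ := hT
  exact ⟨h' y hy (hx.2.trans h), hx.2.trans h⟩

theorem IsSink.eq_of_mem (hT : G.IsSink N T) (hT' : G.IsSink N T') (hN : G.AntClosed N) {x : V}
    (hx : x ∈ T) (hx' : x ∈ T') : T = T' := by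
  ext y
  exact ⟨fun hy => hT'.mem_of_reach hx' (hT.subset hN hy) (hT.reach hx hy),
    fun hy => hT.mem_of_reach hx (hT'.subset hN hy) (hT'.reach hx' hy)⟩

theorem IsSink.antClosed_diff (hT : G.IsSink N T) (hN : G.AntClosed N) : G.AntClosed (N \ T) :=
  fun _ _ h hy => ⟨hN _ _ h hy.1, fun hx => hy.2 (hT.mem_of_reach hx hy.1 (.single h))⟩

theorem exists_isSink [Finite V] {x : V} (hx : x ∈ N) :
    ∃ T, G.IsSink N T ∧ ∃ t ∈ T, ReflTransGen G.AntStep x t := by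
  let _ : Preorder V :=
    { le := ReflTransGen G.AntStep
      le_refl := fun _ => .refl
      le_trans := fun _ _ _ => ReflTransGen.trans }
  obtain ⟨t, hxt, ht⟩ := N.toFinite.exists_le_maximal hx
  exact ⟨_, ⟨t, ht.prop, fun y hy h => ht.le_of_ge hy h, rfl⟩, t, ⟨.refl, .refl⟩, hxt⟩

/-- Every node of `N` is anterior to some sink class; if each class contains `a` or `b`, every node
is anterior or equal to one of them. -/
theorem subset_antPair_or_exists_isSink [Finite V] (N : Set V) (a b : V) :
    N ⊆ G.antPair a b ∨ ∃ T, G.IsSink N T ∧ a ∉ T ∧ b ∉ T := by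
  by_contra! h
  refine h.1 fun x hx => ?_
  obtain ⟨T, hT, t, ht, hxt⟩ := exists_isSink (G := G) hx
  by_cases ha : a ∈ T
  · exact .inl (hxt.trans (hT.reach ht ha))
  · exact .inr (hxt.trans (hT.reach ht (h.2 T hT ha)))

/-- An edge into a sink class exists only for sink classes with a single node, and has an arrowhead
there. -/
theorem IsSink.edge (hG : G.Ribbonless) (hT : G.IsSink N T) (hN : G.AntClosed N) {e : E} {x y : V}
    (he : G.ends e = s(x, y)) (hx : x ∈ N) (hxT : x ∉ T) (hy : y ∈ T) :
    T = {y} ∧ y ∈ G.head e := by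
  have hyx : ¬ ReflTransGen G.AntStep y x := fun h => hxT (hT.mem_of_reach hy hx h)
  -- A tail at `y`, or a line at or below `y`, would make `y` anterior to `x` and so put `x` in `T`.
  have hstep : ¬ (y ∉ G.head e ∨ G.LineAnc y) := fun h => hyx (.single ⟨e, ends_symm he, h⟩)
  rw [not_or, not_not] at hstep
  refine ⟨Set.eq_singleton_iff_unique_mem.2 ⟨hy, fun z hz => ?_⟩, hstep.1⟩
  by_contra hzy
  have h1 := directed_of_reach (hT.reach hy hz) hstep.2
  have h2 := directed_of_reach (hT.reach hz hy) fun h => hstep.2 (h.of_reach h1)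
  -- A second node in `T` creates a directed cycle through `y`. Take the predecessor `w` of `y` on
  -- it: the edge bypassing `y` between `x` and `w` has a tail at `w`, so `w`, and with it `y`, is
  -- anterior to `x`.
  obtain ⟨w, hzw, hwy⟩ := (ReflTransGen.cases_tail h2).resolve_left (Ne.symm hzy)
  have hwT : w ∈ T := hT.mem_of_reach hz (hN _ _ hwy.antStep (hT.subset hN hy))
    (reach_of_directed hzw)
  have hcyc : y ∈ G.RibbonCore := ribbonCore_of_cycle (TransGen.tail' (h1.trans hzw) hwy)
  obtain ⟨f, hf, hwf, hyf⟩ := hwy.exists_edge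
  have hxw : x ≠ w := fun h => hxT (h ▸ hwT)
  obtain ⟨g, hg, -, hg2⟩ := hG.shortcut he (ends_symm hf) hxw hstep.1 hyf hcyc
  exact hyx ((hT.reach hy hwT).tail ⟨g, ends_symm hg, .inl fun h => hwf (hg2.1 h)⟩)

/-! ### Walks with colliders only -/

/-- `a` and `b` are joined by a walk all of whose inner nodes are colliders in `N`. -/
def CollConn (G : LMG V E) (N : Set V) (a b : V) : Prop :=
  ∃ l ha hb, G.Conn N Set.univ l a ha b hb

theorem CollConn.symm {a b : V} (h : G.CollConn N a b) : G.CollConn N b a := by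
  obtain ⟨l, _, _, p⟩ := h
  exact ⟨_, _, _, p.reverse⟩

theorem CollConn.mono {a b : V} (h : G.CollConn N a b) (hN : N ⊆ T) : G.CollConn T a b := by
  obtain ⟨l, _, _, p⟩ := h
  exact ⟨_, _, _, p.mono (fun _ _ hx => hN hx) fun _ _ => id⟩

/-- Trimming the walk at its last visit to `a` and first visit to `b` leaves only inner nodes of
`C`. -/
theorem CollConn.linked {C : Set V} {a b : V} (h : G.CollConn N a b) (hC : N \ {a, b} ⊆ C) :
    G.Linked C a b := by
  obtain ⟨l, _, _, p⟩ := h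
  obtain ⟨l', _, _, ha, hb, -, q⟩ := p.exists_notMem_both
  exact ⟨_, _, _, q.mono (fun x hx hxN => subset_good (hC ⟨hxN, by
    rintro (rfl | rfl) <;> contradiction⟩)) fun _ _ _ => trivial⟩

theorem IsSink.exists_conn (hG : G.Ribbonless) (hT : G.IsSink N T) (hN : G.AntClosed N)
    {l : List V} {a t : V} {ha ht : Prop} (p : G.Conn N Set.univ l a ha t ht) (haN : a ∈ N)
    (haT : a ∉ T) (htT : t ∈ T) : ∃ y l, T = {y} ∧ G.Conn N Set.univ l a ha y True := by
  induction p with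
  | edge e he h1 h2 =>
    obtain ⟨h3, h4⟩ := hT.edge hG hN he haN haT htT
    exact ⟨_, [], h3, .edge e he h1 (by simp [h4])⟩
  | @cons a x t _ h h' _ l e he h1 h2 ok p ih =>
    by_cases hx : x ∈ T
    · obtain ⟨h3, h4⟩ := hT.edge hG hN he haN haT hx
      exact ⟨_, [], h3, .edge e he h1 (by simp [h4])⟩
    · have hc : h ∧ h' := by
        by_contra hc
        exact ok.2 hc trivial
      obtain ⟨y, l', h3, q⟩ := ih (ok.1 hc) hx htT
      exact ⟨y, _, h3, .cons e he h1 h2 ok q⟩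

/-- Any walk entering `T` does so by an arrowhead at its only node, so two such walks meet there in
a collider. -/
theorem IsSink.collConn_trans (hG : G.Ribbonless) (hT : G.IsSink N T) (hN : G.AntClosed N)
    {a b s t : V} (ha : a ∈ N) (haT : a ∉ T) (hb : b ∈ N) (hbT : b ∉ T) (hs : s ∈ T) (ht : t ∈ T)
    (h : G.CollConn N a s) (h' : G.CollConn N b t) : G.CollConn N a b := by
  obtain ⟨l, _, _, p⟩ := h
  obtain ⟨l', _, _, p'⟩ := h'
  obtain ⟨y, m, rfl, q⟩ := hT.exists_conn hG hN p ha haT hs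
  obtain ⟨z, m', hz, q'⟩ := hT.exists_conn hG hN p' hb hbT ht
  obtain rfl := Set.singleton_injective hz
  exact ⟨_, _, _, q.append ⟨fun _ => hT.subset hN rfl, fun h => by simp at h⟩ q'.reverse⟩

theorem IsSink.collConn_of_mem (hG : G.Ribbonless) (hT : G.IsSink N T) (hN : G.AntClosed N)
    {a s t : V} (ha : a ∈ N) (haT : a ∉ T) (hs : s ∈ T) (ht : t ∈ T)
    (h : G.CollConn N a s) : G.CollConn N a t := by
  obtain ⟨l, _, _, p⟩ := h
  obtain ⟨y, m, rfl, q⟩ := hT.exists_conn hG hN p ha haT hs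
  obtain rfl : t = y := ht
  exact ⟨_, _, _, q⟩

/-! ### The pairwise Markov property implies the global one -/

/-- If every node of `N` is anterior or equal to `a` or `b`, this is the pairwise property.
Otherwise a sink class `T` avoids both, the induction hypothesis applies to `N \ T`, and by `hdich`
one of `a`, `b` is not joined to `T`; it remains to make that node independent of each `t ∈ T` given
the rest of `N`. Such statements are proved in `stage₁`, for nodes of different sink classes, and
`stage₂`, for one node in a sink class. -/
theorem PairwiseMarkov.indepRest [Finite V] (hG : G.Ribbonless) {J : IndependenceModel V}
    (hJ : J.IsSemigraphoid) (hI : J.Intersection) (hC : J.Composition) (hP : G.PairwiseMarkov J)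
    (hN : G.AntClosed N) {a b : V} (haN : a ∈ N) (hbN : b ∈ N) (hab : a ≠ b)
    (h : ¬ G.CollConn N a b) : J.IndepRest N a b := by
  induction hn : N.ncard using Nat.strong_induction_on generalizing N a b with
  | _ n IH =>
  subst hn
  have pw : ∀ {a b}, a ∈ N → b ∈ N → a ≠ b → ¬ G.CollConn N a b → N ⊆ G.antPair a b →
      J.IndepRest N a b := by
    intro a b ha hb hab h hsub
    have hadj : ¬ G.Adj a b := fun ⟨e, he⟩ => h ⟨[], _, _, .edge e he Iff.rfl Iff.rfl⟩
    have h1 := hP a b hab hadj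
    have h2 : N = G.antPair a b := hsub.antisymm fun x hx =>
      hx.elim (fun hx => hN.reach hx ha) fun hx => hN.reach hx hb
    rw [antPair_diff, ← h2] at h1
    exact h1
  have ihd : ∀ {T a b}, G.IsSink N T → a ∈ N → a ∉ T → b ∈ N → b ∉ T → a ≠ b →
      ¬ G.CollConn N a b → J.IndepRest (N \ T) a b := by
    intro T a b hT ha haT hb hbT hab h
    obtain ⟨t, ht⟩ := hT.nonempty
    refine IH _ (Set.ncard_lt_ncard ?_) (hT.antClosed_diff hN) ⟨ha, haT⟩ ⟨hb, hbT⟩ hab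
      (fun h' => h (h'.mono Set.sdiff_subset)) rfl
    exact ⟨Set.sdiff_subset, fun hs => (hs (hT.subset hN ht)).2 ht⟩
  -- Deleting one of two sink classes leaves the other intact, so both families of statements come
  -- from the induction hypothesis.
  have htwo : ∀ {T T' a}, G.IsSink N T → G.IsSink N T' → T ≠ T' → a ∈ N → a ∉ T → a ∉ T' →
      (∀ t ∈ T, ¬ G.CollConn N a t) → (∀ t ∈ T', ¬ G.CollConn N a t) →
      ∀ t ∈ T, J.IndepRest N a t := by
    intro T T' a hT hT' hne ha haT haT' h h' t ht
    have hd : Disjoint T T' := Set.disjoint_left.2 fun x hx hx' => hne (hT.eq_of_mem hT' hN hx hx')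
    refine hJ.indepRest_of_two hI hC (hT.subset hN) (hT'.subset hN) hd haT haT'
      (fun s hs => ?_) (fun s hs => ?_) ht
    · exact ihd hT' ha haT' (hT.subset hN hs) (Set.disjoint_left.1 hd hs)
        (fun e => haT (e ▸ hs)) (h s hs)
    · exact ihd hT ha haT (hT'.subset hN hs) (Set.disjoint_right.1 hd hs)
        (fun e => haT' (e ▸ hs)) (h' s hs)
  have hdich : ∀ {T a b}, G.IsSink N T → a ∈ N → a ∉ T → b ∈ N → b ∉ T → ¬ G.CollConn N a b →
      (∀ t ∈ T, ¬ G.CollConn N a t) ∨ (∀ t ∈ T, ¬ G.CollConn N b t) := by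
    intro T a b hT ha haT hb hbT h
    by_contra! hh
    obtain ⟨⟨s, hs, h1⟩, t, ht, h2⟩ := hh
    exact h (hT.collConn_trans hG hN ha haT hb hbT hs ht h1 h2)
  have hall : ∀ {T a b}, G.IsSink N T → a ∈ N → a ∉ T → b ∈ T → ¬ G.CollConn N a b →
      ∀ t ∈ T, ¬ G.CollConn N a t := fun hT ha haT hb h t ht h' =>
    h (hT.collConn_of_mem hG hN ha haT ht hb h')
  have stage₁ : ∀ {T₁ T₂ a b}, G.IsSink N T₁ → G.IsSink N T₂ → a ∈ T₁ → b ∈ T₂ → T₁ ≠ T₂ →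
      ¬ G.CollConn N a b → J.IndepRest N a b := by
    intro T₁ T₂ a b hT₁ hT₂ ha hb hne h
    have ha' := hT₁.subset hN ha
    have hb' := hT₂.subset hN hb
    have ha₂ : a ∉ T₂ := fun h => hne (hT₁.eq_of_mem hT₂ hN ha h)
    have hb₁ : b ∉ T₁ := fun h => hne (hT₁.eq_of_mem hT₂ hN h hb)
    rcases subset_antPair_or_exists_isSink (G := G) N a b with hs | ⟨T, hT, haT, hbT⟩
    · exact pw ha' hb' (fun e => ha₂ (e ▸ hb)) h hs
    · rcases hdich hT ha' haT hb' hbT h with h' | h'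
      · exact htwo hT₂ hT (fun e => hbT (e ▸ hb)) ha' ha₂ haT (hall hT₂ ha' ha₂ hb h) h' b hb
      · exact hJ.indepRest_symm (htwo hT₁ hT (fun e => haT (e ▸ ha)) hb' hb₁ hbT
          (hall hT₁ hb' hb₁ ha fun h' => h h'.symm) h' a ha)
  have stage₂ : ∀ {T a b}, G.IsSink N T → a ∈ N → a ∉ T → b ∈ T → ¬ G.CollConn N a b →
      J.IndepRest N a b := by
    intro T a b hT ha haT hb h
    have hb' := hT.subset hN hb
    have hab : a ≠ b := fun e => haT (e ▸ hb)
    rcases subset_antPair_or_exists_isSink (G := G) N a b with hs | ⟨T', hT', haT', hbT'⟩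
    · exact pw ha hb' hab h hs
    · have hne : T ≠ T' := fun e => hbT' (e ▸ hb)
      -- If `a` is not joined to `T'`, two sink classes are available for `htwo`. Otherwise `b` is
      -- not joined to `T'`, and `stage₁` applies to `b` and the nodes of `T'`.
      rcases hdich hT' ha haT' hb' hbT' h with h' | h'
      · exact htwo hT hT' hne ha haT haT' (hall hT ha haT hb h) h' b hb
      · exact hJ.indepRest_symm (hJ.indepRest_of_diff hI (hT'.subset hN) hbT' ha haT' hab.symm
          (ihd hT' hb' hbT' ha haT' hab.symm fun h' => h h'.symm)
          fun t ht => stage₁ hT hT' hb ht hne (h' t ht))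
  rcases subset_antPair_or_exists_isSink (G := G) N a b with hs | ⟨T, hT, haT, hbT⟩
  · exact pw haN hbN hab h hs
  · rcases hdich hT haN haT hbN hbT h with h' | h'
    · exact hJ.indepRest_of_diff hI (hT.subset hN) haT hbN hbT hab
        (ihd hT haN haT hbN hbT hab h) fun t ht => stage₂ hT haN haT ht (h' t ht)
    · exact hJ.indepRest_symm (hJ.indepRest_of_diff hI (hT.subset hN) hbT haN haT hab.symm
        (ihd hT hbN hbT haN haT hab.symm fun h' => h h'.symm)
        fun t ht => stage₂ hT hbN hbT ht (h' t ht))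

/-! ### Weakly connecting walks under a change of the conditioning set -/

theorem reach_or_mem_good {C : Set V} {r x : V} (hx : x ∈ G.Good (insert r C)) :
    x ∈ G.Good C ∨ ReflTransGen G.Arrow x r := by
  rcases hx with ⟨c, rfl | hc, hx⟩ | hx
  · exact .inr hx
  · exact .inl (.inl ⟨c, hc, hx⟩)
  · exact .inl (.inr hx)

/-- A walk that is weakly connecting given `C ∪ {r}` is so given `C`, or has an initial part that is
weakly connecting given `C` and leads to an ancestor of `r`. -/
theorem Conn.exists_prefix {C : Set V} {r : V} {l : List V} {a b : V} {ha hb : Prop}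
    (p : G.Conn (G.Good (insert r C)) (insert r C) l a ha b hb) :
    G.Conn (G.Good C) C l a ha b hb ∨ ∃ s l', s ∉ G.Good C ∧ ReflTransGen G.Arrow s r ∧
      G.Conn (G.Good C) C l' a ha s True := by
  induction p with
  | edge e he h1 h2 => exact .inl (.edge e he h1 h2)
  | @cons a x b ha h h' hb l e he h1 h2 ok p ih =>
    by_cases hc : (h ∧ h') ∧ x ∉ G.Good C
    · exact .inr ⟨x, [], hc.2, (reach_or_mem_good (ok.1 hc.1)).resolve_left hc.2,
        .edge e he h1 (by simp [← h2, hc.1.1])⟩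
    · have ok' : Passes (G.Good C) C h x h' :=
        ⟨fun hh => by by_contra hx; exact hc ⟨hh, hx⟩, fun hh hx => ok.2 hh (.inr hx)⟩
      rcases ih with ih | ⟨s, l', h3, h4, q⟩
      · exact .inl (.cons e he h1 h2 ok' ih)
      · exact .inr ⟨s, _, h3, h4, .cons e he h1 h2 ok' q⟩

theorem Conn.linked_of_directed {C : Set V} {l : List V} {a s b : V} {ha : Prop}
    (p : G.Conn (G.Good C) C l a ha s True) (hs : s ∉ G.Good C) (h : ReflTransGen G.Arrow s b) :
    G.Linked C a b := by
  rcases reflTransGen_iff_eq_or_transGen.1 h with rfl | h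
  · exact ⟨_, _, _, p⟩
  · obtain ⟨l', q⟩ := Conn.of_directed h hs
    exact ⟨_, _, _, p.append ⟨fun h => h.2.elim, fun _ h => hs (subset_good h)⟩ q⟩

/-- The first collider made admissible only by `b` is an ancestor of `b`; from there a directed path
leads to `b` instead. -/
theorem Linked.of_insert_right {C : Set V} {a b r : V} (h : G.Linked (insert b C) a r) :
    G.Linked C a b ∨ G.Linked C a r := by
  obtain ⟨l, _, _, p⟩ := h
  rcases p.exists_prefix with p | ⟨s, l', h1, h2, q⟩
  · exact .inr ⟨_, _, _, p⟩
  · exact .inl (q.linked_of_directed h1 h2)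

/-- Anteriors of the end nodes and of the conditioning set may be added to the latter. -/
theorem Linked.of_insert_anterior {C : Set V} {a b r z : V} (hz : z ∈ insert a (insert b C))
    (hr : ReflTransGen G.AntStep r z) (h : G.Linked (insert r C) a b) : G.Linked C a b := by
  obtain ⟨l, _, _, p⟩ := h
  -- A node that is not good has no line below it, so the anterior path through `r` to `z` is
  -- directed.
  have hdir : ∀ {s}, s ∉ G.Good C → ReflTransGen G.Arrow s r → ReflTransGen G.Arrow s z :=
    fun hs h => directed_of_reach ((reach_of_directed h).trans hr) fun h => hs (.inr h.ribbonCore)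
  rcases hz with rfl | rfl | hz
  · rcases p.reverse.exists_prefix with p | ⟨s, l', h1, h2, q⟩
    · exact ⟨_, _, _, p.reverse⟩
    · exact (q.linked_of_directed h1 (hdir h1 h2)).symm
  · rcases p.exists_prefix with p | ⟨s, l', h1, h2, q⟩
    · exact ⟨_, _, _, p⟩
    · exact q.linked_of_directed h1 (hdir h1 h2)
  · rcases p.exists_prefix with p | ⟨s, l', h1, h2, q⟩
    · exact ⟨_, _, _, p⟩
    · exact (h1 (.inl ⟨z, hz, hdir h1 h2⟩)).elim

/-- Each walk is stopped at its first visit to `r`, so that `r` occurs only at the junction. There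
it is a collider, admissible given `insert r C`, or a non-collider, admissible given `C`. -/
theorem Linked.trans {C : Set V} {a b r : V} (hr : r ∉ C) (h : G.Linked C a r)
    (h' : G.Linked C b r) : G.Linked C a b ∨ G.Linked (insert r C) a b := by
  obtain ⟨_, _, _, p⟩ := h
  obtain ⟨_, _, _, p'⟩ := h'
  obtain ⟨l, k, hl, -, q⟩ := p.exists_notMem_right
  obtain ⟨l', k', hl', -, q'⟩ := p'.exists_notMem_right
  by_cases hk : k ∧ k'
  · have hm : ∀ {m : List V}, r ∉ m → ∀ x ∈ m, x ∈ insert r C → x ∈ C := by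
      rintro m hm x hx (rfl | hxC)
      · exact (hm hx).elim
      · exact hxC
    have hmono := good_mono (G := G) (Set.subset_insert r C)
    exact .inr ⟨_, _, _, (q.mono (fun _ _ hx => hmono hx) (hm hl)).append
      ⟨fun _ => subset_good (Set.mem_insert r C), fun h => (h hk).elim⟩
      (q'.mono (fun _ _ hx => hmono hx) (hm hl')).reverse⟩
  · exact .inl ⟨_, _, _, q.append ⟨fun h => (hk h).elim, fun _ => hr⟩ q'.reverse⟩

/-- Induction on the number of nodes outside `C`. If `{a, b} ∪ C` is anterior-closed,
`PairwiseMarkov.indepRest` applies. Otherwise a missing anterior `r` can be added to `C` without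
linking `a` and `b`, and by `Linked.trans` one of them, say `a`, is not linked to `r`. Intersection
of the statements for `b` given `C ∪ {r}` and for `r` given `C ∪ {b}` gives the claim. -/
theorem PairwiseMarkov.indep_singleton [Finite V] (hG : G.Ribbonless) {J : IndependenceModel V}
    (hJ : J.IsSemigraphoid) (hI : J.Intersection) (hC : J.Composition) (hP : G.PairwiseMarkov J)
    {C : Set V} {a b : V} (hab : a ≠ b) (ha : a ∉ C) (hb : b ∉ C) (h : ¬ G.Linked C a b) :
    J.Indep {a} {b} C := by
  induction hn : (Cᶜ).ncard using Nat.strong_induction_on generalizing C a b with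
  | _ n IH =>
  subst hn
  let N : Set V := {x | ∃ z ∈ insert a (insert b C), ReflTransGen G.AntStep x z}
  have hN : G.AntClosed N := by
    rintro x y hxy ⟨z, hz, hy⟩
    exact ⟨z, hz, .head hxy hy⟩
  have hsub : insert a (insert b C) ⊆ N := fun x hx => ⟨x, hx, .refl⟩
  by_cases hNC : N ⊆ insert a (insert b C)
  · have e : N \ {a, b} = C := by
      rw [hNC.antisymm hsub]
      ext x
      have : x ∈ C → x ≠ a ∧ x ≠ b := fun hx => ⟨fun e => ha (e ▸ hx), fun e => hb (e ▸ hx)⟩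
      simp only [Set.mem_sdiff, Set.mem_insert_iff, Set.mem_singleton_iff]
      tauto
    have := hP.indepRest hG hJ hI hC hN (hsub (by simp)) (hsub (by simp)) hab
      fun h' => h (h'.linked e.le)
    unfold IndependenceModel.IndepRest at this
    rwa [e] at this
  · obtain ⟨r, ⟨z, hz, hr⟩, hrn⟩ := Set.not_subset.1 hNC
    simp only [Set.mem_insert_iff, not_or] at hrn
    obtain ⟨hra, hrb, hrC⟩ := hrn
    have hlt : ∀ {s}, s ∉ C → ((insert s C)ᶜ).ncard < (Cᶜ).ncard := fun {s} hs =>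
      Set.ncard_lt_ncard ⟨Set.compl_subset_compl.2 (Set.subset_insert _ _),
        fun h => h (a := s) hs (by simp)⟩
    have hstep : ¬ G.Linked (insert r C) a b := fun h' => h (h'.of_insert_anterior hz hr)
    have h1 : J.Indep {a} {b} (insert r C) :=
      IH _ (hlt hrC) hab (by simp [Ne.symm hra, ha]) (by simp [Ne.symm hrb, hb]) hstep rfl
    have key : ∀ {a b}, a ≠ b → a ∉ C → b ∉ C → r ≠ a → r ≠ b → ¬ G.Linked C a b →
        ¬ G.Linked C a r → J.Indep {a} {b} (insert r C) → J.Indep {a} {b} C := by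
      intro a b hab ha hb hra hrb h har h1
      have h2 : J.Indep {a} {r} (insert b C) :=
        IH _ (hlt hb) hra.symm (by simp [hab, ha]) (by simp [hrb, hrC])
          (fun h' => h'.of_insert_right.elim h har) rfl
      rw [← Set.union_singleton] at h1 h2
      exact hJ.decomposition (hI {a} {b} C {r} (by simpa using hab) (by simpa) (by simpa using hra.symm)
        (by simpa) (by simpa using hrb.symm) (by simpa) h1 h2)
    by_cases har : G.Linked C a r
    · have hbr : ¬ G.Linked C b r := fun hbr => (har.trans hrC hbr).elim h hstep
      exact hJ.symm (key hab.symm hb ha hrb hra (fun h' => h h'.symm) hbr (hJ.symm h1))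
    · exact key hab ha hb hra hrb h har h1

theorem PairwiseMarkov.globalMarkov [Finite V] (hG : G.Ribbonless) {J : IndependenceModel V}
    (hJ : J.IsSemigraphoid) (hI : J.Intersection) (hC : J.Composition)
    (hP : G.PairwiseMarkov J) : G.GlobalMarkov J := by
  intro A B C hAB hAC hBC hsep
  rw [mSep_iff hG hAB] at hsep
  refine IndependenceModel.indep_of_forall_composition hC hAC fun b hb => hJ.symm ?_
  refine IndependenceModel.indep_of_forall_composition hC
    (Set.disjoint_singleton_left.2 (Set.disjoint_left.1 hBC hb)) fun a ha => hJ.symm ?_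
  exact hP.indep_singleton hG hJ hI hC (hAB.ne_of_mem ha hb) (Set.disjoint_left.1 hAC ha)
    (Set.disjoint_left.1 hBC hb) (hsep a ha b hb)

theorem GlobalMarkov.pairwiseMarkov (hG : G.Ribbonless) (hmax : G.Maximal)
    {J : IndependenceModel V} (h : G.GlobalMarkov J) : G.PairwiseMarkov J := by
  intro i j hij hadj
  have hd : Disjoint ({i} : Set V) {j} := by simpa using hij
  refine h _ _ _ hd (by simp) (by simp) ((mSep_iff hG hd).2 ?_)
  rintro _ rfl _ rfl
  rw [antPair_diff]
  exact hmax.not_linked hG hij hadj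

end LMG

theorem mainTheorem6 {V : Type u} [Finite V] {E : Type v} (G : LMG V E)
    (hribbonless : G.Ribbonless) (hmaximal : G.Maximal)
    (J : IndependenceModel V) (hprob : IndependenceModel.IsProbabilistic.{u, w} J)
    (hinter : J.Intersection) (hcomp : J.Composition) :
    G.PairwiseMarkov J ↔ G.GlobalMarkov J :=
  ⟨fun h => h.globalMarkov hribbonless hprob.isSemigraphoid hinter hcomp,
    fun h => h.pairwiseMarkov hribbonless hmaximal⟩
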